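/- Let $c_1,\dots,c_r\in(0,1)$ be finitely many distinct points and let $f:[0,1]\to\mathbb R$ be twice differentiable on $[0,1]\setminus\{c_1,\dots,c_r\}$ (one-sidedly at $0$ and $1$) with bounded second derivative there. Suppose that at each $c_j$ both one-sided limits $f(c_j-)$ and $f(c_j+)$ exist and are finite, and that $f>2+\epsilon$ on $[0,1]$ for some $\epsilon>0$. Let $T_n(f)$ be the $n\times n$ tridiagonal matrix with diagonal entries $f(1/n),f(2/n),\dots,f(n/n)$ and all entries directly above and below the diagonal equal to $-1$; put $D_n(f)=\det T_n(f)$ and $$G(f)=\exp\left\{\int_0^1\log\left(\frac{f(x)+\sqrt{f(x)^2-4}}{2}\right)dx\right\}.$$ Define $$\alpha=\frac12\,\frac{f(1)+\sqrt{f(1)^2-4}}{\sqrt[4]{(f(0)^2-4)(f(1)^2-4)}},\qquad \beta_j=\frac{f(c_j-)-f(c_j+)+\sqrt{f(c_j+)^2-4}+\sqrt{f(c_j-)^2-4}}{2\sqrt[4]{(f(c_j+)^2-4)(f(c_j-)^2-4)}},$$ $$\gamma_j=\frac{f(c_j+)+\sqrt{f(c_j+)^2-4}}{f(c_j-)+\sqrt{f(c_j-)^2-4}},$$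 and let $\{x\}=x-\lfloor x\rfloor$ and $\{x\}'=1+x-\lceil x\rceil$. (i) If $f$ is left-continuous at every $c_j$, i.e. $f(c_j)=f(c_j-)$, then, as $n\to\infty$, $$\frac{D_n(f)}{G(f)^n}=\alpha\prod_{j=1}^r\beta_j\gamma_j^{\{nc_j\}}+o(1).$$ (ii) More generally, if $f$ is left-continuous or right-continuous at each $c_j$, then the same formula holds with $\{nc_j\}$ replaced by $\{nc_j\}'$ for those $j$ at which $f$ is taken to be right-continuous, i.e. $f(c_j)=f(c_j+)$ (in particular, for all $j$ if $f$ is right-continuous at every $c_j$). -/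

import Mathlib

open Filter Topology

noncomputable section

namespace DiscreteSchrodinger

/-- The `n × n` discrete Schrödinger matrix: diagonal entries `f(1/n), f(2/n), …, f(n/n)`,
entries `-1` directly above and below the diagonal, and `0` elsewhere.
The index `i : Fin n` runs over `0, …, n - 1`. -/
def T (n : ℕ) (f : ℝ → ℝ) : Matrix (Fin n) (Fin n) ℝ :=
  Matrix.of fun i j =>
    if i = j then f (((i : ℕ) + 1 : ℝ) / (n : ℝ))
    else if (i : ℕ) + 1 = (j : ℕ) ∨ (j : ℕ) + 1 = (i : ℕ) then -1
    else 0

/-- `D_n(f) = det T_n(f)`. -/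
def D (n : ℕ) (f : ℝ → ℝ) : ℝ := (T n f).det

/-- `G(f) = exp ∫₀¹ log ((f(x) + √(f(x)² - 4)) / 2) dx`. -/
def G (f : ℝ → ℝ) : ℝ :=
  Real.exp (∫ x in (0 : ℝ)..1, Real.log ((f x + Real.sqrt (f x ^ 2 - 4)) / 2))

/-- `f` is twice differentiable at every point of `S`, relative to `S`, with a second derivative
that is bounded on `S`. (Here `f₁` is the first and `f₂` the second derivative. For
`S = [0,1] \ {finitely many interior points}` these are ordinary derivatives at the interior
points of `S` and one-sided derivatives at `0` and `1`.) -/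
def TwiceDiffBddOn (f : ℝ → ℝ) (S : Set ℝ) : Prop :=
  ∃ f₁ f₂ : ℝ → ℝ, ∃ M : ℝ, ∀ x ∈ S,
    HasDerivWithinAt f (f₁ x) S x ∧ HasDerivWithinAt f₁ (f₂ x) S x ∧ |f₂ x| ≤ M

/-- The constant `α`, as a function of `a = f(0)` and `b = f(1)`. -/
def alpha (a b : ℝ) : ℝ :=
  (1 / 2) * ((b + Real.sqrt (b ^ 2 - 4)) / ((a ^ 2 - 4) * (b ^ 2 - 4)) ^ (1 / 4 : ℝ))

/-- The constant `β`, as a function of the one-sided limits `l = f(c-)` and `u = f(c+)`. -/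
def beta (l u : ℝ) : ℝ :=
  (l - u + Real.sqrt (u ^ 2 - 4) + Real.sqrt (l ^ 2 - 4)) /
    (2 * ((u ^ 2 - 4) * (l ^ 2 - 4)) ^ (1 / 4 : ℝ))

/-- The constant `γ`, as a function of the one-sided limits `l = f(c-)` and `u = f(c+)`. -/
def gamma (l u : ℝ) : ℝ :=
  (u + Real.sqrt (u ^ 2 - 4)) / (l + Real.sqrt (l ^ 2 - 4))

/-- `{x}' = 1 + x - ⌈x⌉`: the fractional part of `x`, but equal to `1` if `x` is an integer. -/
def fract' (x : ℝ) : ℝ := 1 + x - (⌈x⌉ : ℝ)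

end DiscreteSchrodinger

end

/-! Write `f (k/n) = 2 cosh a_k` and `m_k = exp (-a_k)`. The leading principal minors satisfy
`D_{k+1} = 2 cosh(a_{k+1}) D_k - D_{k-1}`, a recurrence with growing root `exp a_k` and decaying
root `m_k`. With `r_k = D_{k-1}/D_k`, the quantity `D_k (1 - r_k m_k) = D_k - m_k D_{k-1}` is
multiplied, from `k` to `k+1`, by exactly `exp(a_{k+1}) (1 - r_k m_{k+1}) / (1 - r_k m_k)`.
Replacing `r_k` by `m_k` here leaves `hbeta a_k a_{k+1}` times a telescoping quotient of square
roots, with relative error `defect`, which is proportional to `(m_k - r_k)(m_{k+1} - m_k)`. This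
gives the exact product formula `det_tridiag_mul_one_sub`.

The defects are summable to zero (`StepArray.tendsto_sum_defect`). The map `r_k ↦ r_{k+1}` contracts
towards the decaying root, so `∑ |r_k - m_k|` stays bounded. On smooth cells `m` varies by `O(1/n)`;
at a jump it varies by `O(1)`, but `r - m` has already decayed there because jumps are far from each
other and from `0`.

In the main term, `G f ^ n` is split over the grid cells. On a smooth cell, `log hbeta x y = (x -
y)/2 + O((x - y)^2)` turns the factor into the exponential of a trapezoidal sum, so after division
by the integral the logarithm is `O(1/n^2)`. On the cell `[k/n, (k+1)/n]` containing a jump, put `t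
= n c - k`; the integral is close to `(t a(c-) + (1 - t) a(c+))/n`, and the quotient is close to `β
γ^t`. The boundary terms at `0` and `1` give `α`. -/

noncomputable section

namespace DiscreteSchrodinger

/-! ### Tridiagonal determinants and ratios of consecutive minors -/

/-- The tridiagonal matrix with diagonal entries `d 1, …, d n` and off-diagonal entries `-1`. -/
def tridiag (d : ℕ → ℝ) (n : ℕ) : Matrix (Fin n) (Fin n) ℝ :=
  Matrix.of fun i j =>
    if i = j then d ((i : ℕ) + 1)
    else if (i : ℕ) + 1 = (j : ℕ) ∨ (j : ℕ) + 1 = (i : ℕ) then -1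
    else 0

theorem det_tridiag_zero (d : ℕ → ℝ) : (tridiag d 0).det = 1 := by simp

theorem det_tridiag_one (d : ℕ → ℝ) : (tridiag d 1).det = d 1 := by
  simp [tridiag]

theorem tridiag_submatrix_castSucc (d : ℕ → ℝ) (n : ℕ) :
    (tridiag d (n + 1)).submatrix Fin.castSucc Fin.castSucc = tridiag d n := by
  ext i j
  simp [tridiag, Fin.ext_iff]

theorem det_tridiag_succ_succ (d : ℕ → ℝ) (n : ℕ) :
    (tridiag d (n + 2)).det = d (n + 2) * (tridiag d (n + 1)).det - (tridiag d n).det := by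
  -- The last column of this minor is zero except for the `-1` at the bottom.
  have hminor : ((tridiag d (n + 2)).submatrix Fin.castSucc
      (Fin.castSucc (Fin.last n)).succAbove).det = -(tridiag d n).det := by
    rw [Matrix.det_succ_column _ (Fin.last n), Fin.sum_univ_castSucc, Finset.sum_eq_zero]
    · have h1 : ((tridiag d (n + 2)).submatrix Fin.castSucc
          (Fin.castSucc (Fin.last n)).succAbove).submatrix (Fin.last n).succAbove
          (Fin.last n).succAbove = tridiag d n := by
        ext i j
        have : (Fin.castSucc (Fin.last n)).succAbove (Fin.castSucc j)
            = Fin.castSucc (Fin.castSucc j) :=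
          Fin.succAbove_of_castSucc_lt _ _ (by simp [Fin.lt_def])
        simp [tridiag, Fin.ext_iff, this]
      have h2 : (Fin.castSucc (Fin.last n)).succAbove (Fin.last n) = Fin.last (n + 1) := by
        rw [Fin.succAbove_of_le_castSucc _ _ le_rfl, Fin.succ_last]
      rw [h1]
      simp [tridiag, h2, Fin.ext_iff, ← two_mul]
    · intro i _
      have h2 : (Fin.castSucc (Fin.last n)).succAbove (Fin.last n) = Fin.last (n + 1) := by
        rw [Fin.succAbove_of_le_castSucc _ _ le_rfl, Fin.succ_last]
      have hi := i.isLt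
      have : tridiag d (n + 2) (Fin.castSucc (Fin.castSucc i)) (Fin.last (n + 1)) = 0 := by
        simp only [tridiag, Matrix.of_apply, Fin.ext_iff, Fin.val_castSucc, Fin.val_last]
        rw [if_neg (by omega), if_neg (by omega)]
      simp [h2, this]
  rw [Matrix.det_succ_row _ (Fin.last (n + 1)), Fin.sum_univ_castSucc, Fin.sum_univ_castSucc,
    Finset.sum_eq_zero]
  · rw [Fin.succAbove_last, hminor, tridiag_submatrix_castSucc]
    have h1 : tridiag d (n + 2) (Fin.last (n + 1)) (Fin.last (n + 1)) = d (n + 2) := by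
      simp [tridiag]
    have h2 : tridiag d (n + 2) (Fin.last (n + 1)) (Fin.castSucc (Fin.last n)) = -1 := by
      simp [tridiag, Fin.ext_iff]
    rw [h1, h2]
    simp only [Fin.val_last, Fin.val_castSucc, ← two_mul, pow_mul]
    have h3 : (-1 : ℝ) ^ (n + 1 + n) = -1 := by
      rw [show n + 1 + n = 2 * n + 1 by ring, pow_succ, pow_mul]; simp
    rw [h3]; simp; ring
  · intro i _
    have hi := i.isLt
    have : tridiag d (n + 2) (Fin.last (n + 1)) (Fin.castSucc (Fin.castSucc i)) = 0 := by
      simp only [tridiag, Matrix.of_apply, Fin.ext_iff, Fin.val_castSucc, Fin.val_last]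
      rw [if_neg (by omega), if_neg (by omega)]
    simp [this]

/-- The ratio of consecutive determinants of tridiagonal matrices with diagonal `2 cosh (a k)`. -/
def ratio (a : ℕ → ℝ) : ℕ → ℝ
  | 0 => 0
  | k + 1 => 1 / (Real.exp (a (k + 1)) + Real.exp (-a (k + 1)) - ratio a k)

theorem two_le_exp_add_exp_neg (x : ℝ) : 2 ≤ Real.exp x + Real.exp (-x) := by
  have h := Real.one_le_cosh x
  rw [Real.cosh_eq] at h
  linarith

theorem ratio_mem (a : ℕ → ℝ) (k : ℕ) : 0 ≤ ratio a k ∧ ratio a k ≤ 1 := by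
  induction k with
  | zero => simp [ratio]
  | succ k ih =>
    have h := two_le_exp_add_exp_neg (a (k + 1))
    rw [ratio]
    exact ⟨one_div_nonneg.2 (by linarith), (div_le_one (by linarith)).2 (by linarith)⟩

theorem ratio_succ_pos (a : ℕ → ℝ) (k : ℕ) : 0 < ratio a (k + 1) := by
  have h := two_le_exp_add_exp_neg (a (k + 1))
  have := ratio_mem a k
  rw [ratio]
  exact one_div_pos.2 (by linarith)

theorem det_tridiag_succ_mul_ratio (a d : ℕ → ℝ)
    (hd : ∀ k, d k = Real.exp (a k) + Real.exp (-a k)) (k : ℕ) :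
    (tridiag d (k + 1)).det * ratio a (k + 1) = (tridiag d k).det := by
  induction k with
  | zero =>
    have h := two_le_exp_add_exp_neg (a 1)
    rw [det_tridiag_one, det_tridiag_zero, hd]
    simp only [ratio, zero_add, sub_zero]
    rw [mul_one_div_cancel (by linarith)]
  | succ k ih =>
    have h := two_le_exp_add_exp_neg (a (k + 2))
    have := ratio_mem a (k + 1)
    have h1 : ratio a (k + 2) *
        (Real.exp (a (k + 2)) + Real.exp (-a (k + 2)) - ratio a (k + 1)) = 1 := by
      rw [ratio, one_div_mul_cancel (by linarith)]
    rw [det_tridiag_succ_succ, ← ih, hd]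
    linear_combination (tridiag d (k + 1)).det * h1

/-- The decaying root `exp (-a (k + 1))` is a fixed point of the map `r ↦ 1 / (2 cosh a (k + 1) -
r)` sending `ratio a k` to `ratio a (k + 1)`. The distance to it is multiplied by `ratio a (k + 1) *
exp (-a (k + 1)) ≤ exp (-σ)`; the second summand accounts for the root moving between steps. -/
theorem abs_ratio_succ_sub_le {a : ℕ → ℝ} {σ : ℝ} (ha : ∀ k, σ ≤ a k) (k : ℕ) :
    |ratio a (k + 1) - Real.exp (-a (k + 1))| ≤
      Real.exp (-σ) * (|ratio a k - Real.exp (-a k)| +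
        |Real.exp (-a (k + 1)) - Real.exp (-a k)|) := by
  have h := two_le_exp_add_exp_neg (a (k + 1))
  have hr := ratio_mem a k
  have hr' := ratio_mem a (k + 1)
  have h0 : Real.exp (a (k + 1)) + Real.exp (-a (k + 1)) - ratio a k ≠ 0 := by linarith
  have key : ratio a (k + 1) - Real.exp (-a (k + 1)) =
      ratio a (k + 1) * Real.exp (-a (k + 1)) * (ratio a k - Real.exp (-a (k + 1))) := by
    have he : Real.exp (a (k + 1)) * Real.exp (-a (k + 1)) = 1 := by
      rw [← Real.exp_add]; simp
    have h1 : ratio a (k + 1) *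
        (Real.exp (a (k + 1)) + Real.exp (-a (k + 1)) - ratio a k) = 1 := by
      rw [ratio, one_div_mul_cancel h0]
    linear_combination Real.exp (-a (k + 1)) * h1 - ratio a (k + 1) * he
  rw [key, abs_mul, abs_of_nonneg (mul_nonneg hr'.1 (Real.exp_pos _).le)]
  have h2 : ratio a (k + 1) * Real.exp (-a (k + 1)) ≤ Real.exp (-σ) := by
    have h3 : Real.exp (-a (k + 1)) ≤ Real.exp (-σ) :=
      Real.exp_le_exp.2 (neg_le_neg (ha _))
    nlinarith [Real.exp_pos (-a (k + 1))]
  refine mul_le_mul h2 ?_ (abs_nonneg _) (Real.exp_pos _).le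
  rw [abs_sub_comm (Real.exp (-a (k + 1))) (Real.exp (-a k))]
  exact abs_sub_le _ _ _

/-! ### Exact product formula for the determinant -/

/-- `2 sinh x`. -/
def wt (x : ℝ) : ℝ := Real.exp x - Real.exp (-x)

theorem wt_pos {x : ℝ} (hx : 0 < x) : 0 < wt x := by
  have : Real.exp (-x) < Real.exp x := Real.exp_lt_exp.2 (by linarith)
  unfold wt; linarith

/-- The constant `beta` in the coordinates `l = 2 cosh x`, `u = 2 cosh y`. -/
def hbeta (x y : ℝ) : ℝ := (Real.exp x - Real.exp (-y)) / √(wt x * wt y)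

theorem hbeta_pos {x y : ℝ} (hx : 0 < x) (hy : 0 < y) : 0 < hbeta x y := by
  have : Real.exp (-y) < Real.exp x := Real.exp_lt_exp.2 (by linarith)
  exact div_pos (by linarith) (Real.sqrt_pos.2 (mul_pos (wt_pos hx) (wt_pos hy)))

/-- The relative defect of the leading-order transfer at step `k`. -/
def defect (a : ℕ → ℝ) (k : ℕ) : ℝ :=
  (Real.exp (-a k) - ratio a k) * (Real.exp (-a (k + 1)) - Real.exp (-a k)) /
    ((1 - ratio a k * Real.exp (-a k)) * (1 - Real.exp (-a k) * Real.exp (-a (k + 1))))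

theorem exp_neg_lt_one {x : ℝ} (hx : 0 < x) : Real.exp (-x) < 1 := by
  rw [Real.exp_lt_one_iff]; linarith

/-- The left side is `D_n - exp (-a n) D_{n-1}`, which removes the locally decaying mode. The value
`a 0` does not enter the determinant; since `ratio a 0 = 0` it can be chosen freely, and `a 0 =
logRoot (f 0)` later produces the dependence on `f 0`. -/
theorem det_tridiag_mul_one_sub (a d : ℕ → ℝ) (ha : ∀ k, 0 < a k)
    (hd : ∀ k, d k = Real.exp (a k) + Real.exp (-a k)) (n : ℕ) :
    (tridiag d n).det * (1 - ratio a n * Real.exp (-a n)) = √(wt (a n) / wt (a 0)) *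
      ∏ k ∈ Finset.range n, (Real.exp (a (k + 1)) * hbeta (a k) (a (k + 1)) *
        (1 + defect a k)) := by
  induction n with
  | zero => simp [ratio, div_self (wt_pos (ha 0)).ne']
  | succ n ih =>
    rw [Finset.prod_range_succ]
    set P := ∏ k ∈ Finset.range n, (Real.exp (a (k + 1)) * hbeta (a k) (a (k + 1)) *
        (1 + defect a k)) with hP
    have hr := ratio_mem a n
    have hm := exp_neg_lt_one (ha n)
    have hm' := exp_neg_lt_one (ha (n + 1))
    have hp := Real.exp_pos (-a n)
    have hp' := Real.exp_pos (-a (n + 1))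
    have hrpos := ratio_succ_pos a n
    have hdet := det_tridiag_succ_mul_ratio a d hd n
    have h0 := two_le_exp_add_exp_neg (a (n + 1))
    have h1 : ratio a (n + 1) *
        (Real.exp (a (n + 1)) + Real.exp (-a (n + 1)) - ratio a n) = 1 := by
      rw [ratio, one_div_mul_cancel (by linarith)]
    have he : Real.exp (a (n + 1)) * Real.exp (-a (n + 1)) = 1 := by
      rw [← Real.exp_add]; simp
    have hrm : 0 < 1 - ratio a n * Real.exp (-a n) := by nlinarith
    have hmm : 0 < 1 - Real.exp (-a n) * Real.exp (-a (n + 1)) := by nlinarith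
    -- This is `D_{n+1} - m' D_n = exp(a (n+1)) (D_n - m' D_{n-1})` with `m' = exp (-a (n+1))`,
    -- which holds since `m'` is a characteristic root at step `n + 1`.
    have hlhs : (tridiag d (n + 1)).det * (1 - ratio a (n + 1) * Real.exp (-a (n + 1))) =
        (tridiag d n).det * Real.exp (a (n + 1)) * (1 - ratio a n * Real.exp (-a (n + 1))) := by
      rw [← hdet]
      linear_combination (-(tridiag d (n + 1)).det * h1 +
        (tridiag d (n + 1)).det * ratio a (n + 1) * ratio a n * he)
    have hw0 := wt_pos (ha 0)
    have hwn := wt_pos (ha n)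
    have hwn' := wt_pos (ha (n + 1))
    have hwn2 : wt (a n) = Real.exp (a n) * (1 - Real.exp (-a n) * Real.exp (-a n)) := by
      have : Real.exp (a n) * Real.exp (-a n) = 1 := by rw [← Real.exp_add]; simp
      unfold wt; linear_combination Real.exp (-a n) * this
    -- The transfer factor for `ratio a n = exp (-a n)` becomes the symmetrically normalised `hbeta`
    -- once a telescoping `√(wt (a (n + 1)) / wt (a n))` is split off.
    have hbn : √(wt (a (n + 1)) / wt (a 0)) * hbeta (a n) (a (n + 1)) = √(wt (a n) / wt (a 0)) *
        ((1 - Real.exp (-a n) * Real.exp (-a (n + 1))) /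
          (1 - Real.exp (-a n) * Real.exp (-a n))) := by
      have hs := Real.sq_sqrt hwn.le
      have hsp := Real.sqrt_pos.2 hwn
      have hsp' := Real.sqrt_pos.2 hwn'
      have hsp0 := Real.sqrt_pos.2 hw0
      have hen : Real.exp (a n) * Real.exp (-a n) = 1 := by rw [← Real.exp_add]; simp
      have hnum : Real.exp (a n) - Real.exp (-a (n + 1)) =
          Real.exp (a n) * (1 - Real.exp (-a n) * Real.exp (-a (n + 1))) := by
        linear_combination Real.exp (-a (n + 1)) * hen
      have hd2 : 0 < 1 - Real.exp (-a n) * Real.exp (-a n) := by nlinarith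
      unfold hbeta
      rw [Real.sqrt_div hwn.le, Real.sqrt_div hwn'.le, Real.sqrt_mul hwn.le, hnum]
      field_simp
      rw [hs, hwn2]
      have hd3 : 1 - Real.exp (-a n) ^ 2 ≠ 0 := by rw [sq]; exact hd2.ne'
      field_simp
    have hη : (1 - Real.exp (-a n) * Real.exp (-a (n + 1))) /
          (1 - Real.exp (-a n) * Real.exp (-a n)) * (1 + defect a n) =
        (1 - ratio a n * Real.exp (-a (n + 1))) / (1 - ratio a n * Real.exp (-a n)) := by
      have hd2 : 0 < 1 - Real.exp (-a n) * Real.exp (-a n) := by nlinarith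
      unfold defect
      rw [div_mul_eq_mul_div, div_eq_div_iff hd2.ne' hrm.ne']
      rw [one_add_div (by positivity), mul_div_assoc', div_mul_eq_mul_div,
        div_eq_iff (by positivity)]
      ring
    have hD : (tridiag d n).det = √(wt (a n) / wt (a 0)) * P /
        (1 - ratio a n * Real.exp (-a n)) := by
      rw [eq_div_iff hrm.ne', ih]
    calc _ = √(wt (a n) / wt (a 0)) * P * Real.exp (a (n + 1)) *
          ((1 - ratio a n * Real.exp (-a (n + 1))) / (1 - ratio a n * Real.exp (-a n))) := by
          rw [hlhs, hD]; ring
      _ = (√(wt (a n) / wt (a 0)) * ((1 - Real.exp (-a n) * Real.exp (-a (n + 1))) /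
          (1 - Real.exp (-a n) * Real.exp (-a n)))) * P * Real.exp (a (n + 1)) *
            (1 + defect a n) := by rw [← hη]; ring
      _ = _ := by rw [← hbn]; ring

/-- The defect is second order: the variation of the root times the deviation of the ratio. Both
denominators are bounded below because every root is at most `exp (-σ)`. -/
theorem abs_defect_le {a : ℕ → ℝ} {σ : ℝ} (hσ : 0 < σ) (ha : ∀ k, σ ≤ a k) (k : ℕ) :
    |defect a k| ≤ |Real.exp (-a (k + 1)) - Real.exp (-a k)| *
      |ratio a k - Real.exp (-a k)| / (1 - Real.exp (-σ)) ^ 2 := by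
  have hr := ratio_mem a k
  have hs := exp_neg_lt_one hσ
  have hm : ∀ k, Real.exp (-a k) ≤ Real.exp (-σ) := fun k =>
    Real.exp_le_exp.2 (neg_le_neg (ha _))
  have hp := Real.exp_pos (-a k)
  have hp' := Real.exp_pos (-a (k + 1))
  have h1 : 1 - Real.exp (-σ) ≤ 1 - ratio a k * Real.exp (-a k) := by nlinarith [hm k]
  have h2 : 1 - Real.exp (-σ) ≤ 1 - Real.exp (-a k) * Real.exp (-a (k + 1)) := by
    nlinarith [hm k, hm (k + 1)]
  have h0 : 0 < 1 - Real.exp (-σ) := by linarith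
  unfold defect
  rw [abs_div, abs_mul, abs_sub_comm (Real.exp (-a k)) (ratio a k), mul_comm |ratio a k - _|]
  have hden : (1 - Real.exp (-σ)) ^ 2 ≤ (1 - ratio a k * Real.exp (-a k)) *
      (1 - Real.exp (-a k) * Real.exp (-a (k + 1))) := by
    rw [sq]; exact mul_le_mul h1 h2 h0.le (by linarith)
  refine div_le_div_of_nonneg_left (by positivity) (by positivity) ?_
  exact hden.trans (le_abs_self _)

/-! ### Contraction estimates for the deviation -/

/-- The deviation of `ratio` from the local decaying exponential. -/
def dev (a : ℕ → ℝ) (k : ℕ) : ℝ := |ratio a k - Real.exp (-a k)|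

/-- The variation of the decaying exponential at step `k`. -/
def var (a : ℕ → ℝ) (k : ℕ) : ℝ := |Real.exp (-a (k + 1)) - Real.exp (-a k)|

section Single

variable {a : ℕ → ℝ} {σ : ℝ}

theorem dev_nonneg (a : ℕ → ℝ) (k : ℕ) : 0 ≤ dev a k := abs_nonneg _

theorem var_nonneg (a : ℕ → ℝ) (k : ℕ) : 0 ≤ var a k := abs_nonneg _

theorem dev_le_one (hσ : 0 < σ) (ha : ∀ k, σ ≤ a k) (k : ℕ) : dev a k ≤ 1 := by
  have hr := ratio_mem a k
  have h1 := exp_neg_lt_one (hσ.trans_le (ha k))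
  have h2 := Real.exp_pos (-a k)
  exact abs_le.2 ⟨by linarith, by linarith⟩

theorem abs_exp_neg_sub_le {x y : ℝ} (hx : 0 ≤ x) (hy : 0 ≤ y) :
    |Real.exp (-x) - Real.exp (-y)| ≤ |x - y| := by
  wlog h : x ≤ y generalizing x y
  · rw [abs_sub_comm, abs_sub_comm x y]
    exact this hy hx (le_of_not_ge h)
  have h1 : Real.exp (-y) ≤ Real.exp (-x) := Real.exp_le_exp.2 (by linarith)
  rw [abs_of_nonneg (by linarith), abs_of_nonpos (by linarith)]
  have h2 : Real.exp (-y) = Real.exp (-x) * Real.exp (x - y) := by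
    rw [← Real.exp_add]; ring_nf
  have h3 := Real.add_one_le_exp (x - y)
  have h4 : Real.exp (-x) ≤ 1 := Real.exp_le_one_iff.2 (by linarith)
  have h5 := Real.exp_pos (-x)
  rw [h2]
  nlinarith

theorem var_le_one (hσ : 0 < σ) (ha : ∀ k, σ ≤ a k) (k : ℕ) : var a k ≤ 1 := by
  have h1 := exp_neg_lt_one (hσ.trans_le (ha k))
  have h2 := Real.exp_pos (-a k)
  have h3 := exp_neg_lt_one (hσ.trans_le (ha (k + 1)))
  have h4 := Real.exp_pos (-a (k + 1))
  exact abs_le.2 ⟨by linarith, by linarith⟩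

/-- Iterating the contraction forgets the initial deviation geometrically; a forcing of size `δ`
contributes at most a geometric series. -/
theorem dev_add_le (hσ : 0 < σ) (ha : ∀ k, σ ≤ a k) {δ : ℝ} (hδ : 0 ≤ δ) (k N : ℕ)
    (h : ∀ i, k ≤ i → i < k + N → var a i ≤ δ) :
    dev a (k + N) ≤ Real.exp (-σ) ^ N + δ / (1 - Real.exp (-σ)) := by
  have hs := exp_neg_lt_one hσ
  have hp := Real.exp_pos (-σ)
  set ρ := Real.exp (-σ)
  have hρ : 0 < 1 - ρ := by linarith
  induction N with
  | zero =>
    have := dev_le_one hσ ha k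
    have : 0 ≤ δ / (1 - ρ) := by positivity
    simp; linarith
  | succ N ih =>
    have h1 := ih fun i hi hi' => h i hi (by omega)
    have h2 := h (k + N) (by omega) (by omega)
    have h3 : dev a (k + N + 1) ≤ ρ * (dev a (k + N) + var a (k + N)) :=
      abs_ratio_succ_sub_le ha (k + N)
    -- Equivalent to `ρ (2 - ρ) ≤ 1`, that is `(1 - ρ)^2 ≥ 0`.
    have h4 : ρ * (δ / (1 - ρ) + δ) ≤ δ / (1 - ρ) := by
      rw [div_add' _ _ _ hρ.ne', ← mul_div_assoc]
      gcongr
      nlinarith [mul_nonneg hδ (sq_nonneg (1 - ρ))]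
    calc dev a (k + N + 1) ≤ ρ * (dev a (k + N) + var a (k + N)) := h3
      _ ≤ ρ * ((ρ ^ N + δ / (1 - ρ)) + δ) := by gcongr
      _ = ρ ^ (N + 1) + ρ * (δ / (1 - ρ) + δ) := by ring
      _ ≤ _ := by linarith

/-- Summing the contraction inequality bounds the total deviation by the total variation; the `1`
absorbs the initial deviation, which is not small. Keeping `dev a n` on the left makes the induction
close. -/
theorem sum_dev_le (hσ : 0 < σ) (ha : ∀ k, σ ≤ a k) (n : ℕ) :
    (1 - Real.exp (-σ)) * ∑ k ∈ Finset.range n, dev a k + dev a n ≤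
      1 + ∑ k ∈ Finset.range n, var a k := by
  induction n with
  | zero => simpa using dev_le_one hσ ha 0
  | succ n ih =>
    have hs := exp_neg_lt_one hσ
    have h3 : dev a (n + 1) ≤ Real.exp (-σ) * (dev a n + var a n) :=
      abs_ratio_succ_sub_le ha n
    rw [Finset.sum_range_succ, Finset.sum_range_succ]
    nlinarith [var_nonneg a n]

end Single

/-! ### Arrays with small steps and isolated jumps -/

/-- A triangular array, bounded below by `σ`, whose steps are `O(1/n)` except at the `K j n`,
which are far from each other and from the ends. -/
structure StepArray {r : ℕ} (a : ℕ → ℕ → ℝ) (K : Fin r → ℕ → ℕ) (σ L : ℝ) : Prop where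
  σ_pos : 0 < σ
  L_nonneg : 0 ≤ L
  le : ∀ n k, σ ≤ a n k
  step : ∀ n k, k < n → (∀ j, K j n ≠ k) → |a n (k + 1) - a n k| ≤ L / n
  sep : ∀ N j j', ∀ᶠ n in atTop, ¬ (K j' n < K j n ∧ K j n ≤ K j' n + N)
  left : ∀ N j, ∀ᶠ n in atTop, N ≤ K j n
  right : ∀ N j, ∀ᶠ n in atTop, K j n + N < n

namespace StepArray

variable {r : ℕ} {a : ℕ → ℕ → ℝ} {K : Fin r → ℕ → ℕ} {σ L : ℝ}

theorem var_le (h : StepArray a K σ L) {n k : ℕ} (hk : k < n) (hK : ∀ j, K j n ≠ k) :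
    var (a n) k ≤ L / n :=
  (abs_exp_neg_sub_le (h.σ_pos.le.trans (h.le _ _)) (h.σ_pos.le.trans (h.le _ _))).trans
    (h.step n k hk hK)

/-- If the `N` steps before `κ n` contain no jump, the deviation there is at most `exp (-σ) ^ N +
O(1/n)`. Taking `n → ∞` for each fixed `N` gives the limit. -/
theorem tendsto_dev (h : StepArray a K σ L) (κ : ℕ → ℕ)
    (hκ : ∀ N, ∀ᶠ n in atTop, N ≤ κ n ∧ κ n ≤ n ∧ ∀ j, ¬ (K j n < κ n ∧ κ n ≤ K j n + N)) :
    Tendsto (fun n => dev (a n) (κ n)) atTop (𝓝 0) := by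
  have hs := exp_neg_lt_one h.σ_pos
  have hp := Real.exp_pos (-σ)
  rw [tendsto_order]
  refine ⟨fun x hx => Eventually.of_forall fun n => hx.trans_le (dev_nonneg _ _), fun x hx => ?_⟩
  obtain ⟨N, hN⟩ := exists_pow_lt_of_lt_one (half_pos hx) hs
  have hL : Tendsto (fun n : ℕ => L / n / (1 - Real.exp (-σ))) atTop (𝓝 0) := by
    have := (tendsto_const_div_atTop_nhds_zero_nat L).div_const (1 - Real.exp (-σ))
    simpa using this
  filter_upwards [hκ N, hL.eventually_lt_const (half_pos hx)] with n ⟨h1, h2, h3⟩ h4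
  have := dev_add_le (a := a n) h.σ_pos (h.le n) (δ := L / n)
    (div_nonneg h.L_nonneg (Nat.cast_nonneg _)) (κ n - N) N (fun i hi hi' =>
      h.var_le (by omega) fun j hj => h3 j ⟨by omega, by omega⟩)
  rw [Nat.sub_add_cancel h1] at this
  linarith

theorem tendsto_dev_last (h : StepArray a K σ L) :
    Tendsto (fun n => dev (a n) n) atTop (𝓝 0) := by
  refine h.tendsto_dev (fun n => n) fun N => ?_
  filter_upwards [eventually_ge_atTop N, eventually_all.2 (h.right N)] with n h1 h2
  exact ⟨h1, le_rfl, fun j hj => by have := h2 j; omega⟩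

theorem tendsto_dev_jump (h : StepArray a K σ L) (j : Fin r) :
    Tendsto (fun n => dev (a n) (K j n)) atTop (𝓝 0) := by
  refine h.tendsto_dev (K j) fun N => ?_
  filter_upwards [h.left N j, h.right 0 j, eventually_all.2 (h.sep N j)] with n h1 h2 h3
  exact ⟨h1, by omega, h3⟩

theorem var_le' (h : StepArray a K σ L) {n k : ℕ} (hk : k < n) :
    var (a n) k ≤ L / n + ∑ j, if K j n = k then 1 else 0 := by
  have h0 : 0 ≤ L / n := div_nonneg h.L_nonneg (Nat.cast_nonneg _)
  by_cases hK : ∀ j, K j n ≠ k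
  · have : 0 ≤ ∑ j, if K j n = k then (1 : ℝ) else 0 :=
      Finset.sum_nonneg fun j _ => by split_ifs <;> norm_num
    linarith [h.var_le hk hK]
  · push Not at hK
    obtain ⟨j, hj⟩ := hK
    have : (if K j n = k then (1 : ℝ) else 0) ≤ ∑ j, if K j n = k then (1 : ℝ) else 0 :=
      Finset.single_le_sum (f := fun j => if K j n = k then (1 : ℝ) else 0)
        (fun j _ => by split_ifs <;> norm_num) (Finset.mem_univ j)
    rw [if_pos hj] at this
    linarith [var_le_one h.σ_pos (h.le n) k]

theorem sum_var_mul_le (h : StepArray a K σ L) (n : ℕ) {e : ℕ → ℝ} (he : ∀ k, 0 ≤ e k) :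
    ∑ k ∈ Finset.range n, var (a n) k * e k ≤
      L / n * ∑ k ∈ Finset.range n, e k + ∑ j, e (K j n) := by
  calc _ ≤ ∑ k ∈ Finset.range n, (L / n * e k + ∑ j, if K j n = k then e k else 0) := by
        refine Finset.sum_le_sum fun k hk => ?_
        have := mul_le_mul_of_nonneg_right (h.var_le' (Finset.mem_range.1 hk)) (he k)
        rw [add_mul, Finset.sum_mul] at this
        simpa only [ite_mul, one_mul, zero_mul] using this
    _ ≤ _ := by
        rw [Finset.sum_add_distrib, ← Finset.mul_sum, Finset.sum_comm]
        gcongr with j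
        rw [Finset.sum_ite_eq]
        split_ifs
        · exact le_rfl
        · exact he _

/-- Off the jumps the variation is at most `L / n` and the deviations have bounded sum. At each of
the finitely many jumps the variation is only bounded, but the deviation on entering the jump tends
to zero. -/
theorem tendsto_sum_defect (h : StepArray a K σ L) :
    Tendsto (fun n => ∑ k ∈ Finset.range n, |defect (a n) k|) atTop (𝓝 0) := by
  have hs := exp_neg_lt_one h.σ_pos
  have hρ : 0 < 1 - Real.exp (-σ) := by linarith
  -- Bound for the total deviation: total variation is at most `L` from regular steps and `1` from
  -- each of `r` jumps, and the other `1` comes from `sum_dev_le`.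
  set B := (1 + (L + r)) / (1 - Real.exp (-σ)) with hB
  have hbound : ∀ n, 0 < n → ∑ k ∈ Finset.range n, |defect (a n) k| ≤
      (L / n * B + ∑ j, dev (a n) (K j n)) / (1 - Real.exp (-σ)) ^ 2 := by
    intro n hn
    have h1 : ∑ k ∈ Finset.range n, dev (a n) k ≤ B := by
      rw [hB, le_div_iff₀ hρ]
      have h2 := sum_dev_le h.σ_pos (h.le n) n
      have h3 := h.sum_var_mul_le n (e := fun _ => 1) (by simp)
      have hn' : (n : ℝ) ≠ 0 := by positivity
      simp [hn'] at h3
      nlinarith [dev_nonneg (a n) n]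
    calc _ ≤ ∑ k ∈ Finset.range n, var (a n) k * dev (a n) k / (1 - Real.exp (-σ)) ^ 2 :=
          Finset.sum_le_sum fun k _ => abs_defect_le h.σ_pos (h.le n) k
      _ = (∑ k ∈ Finset.range n, var (a n) k * dev (a n) k) / (1 - Real.exp (-σ)) ^ 2 := by
          rw [Finset.sum_div]
      _ ≤ _ := by
          have h4 := h.sum_var_mul_le n (dev_nonneg (a n))
          have h5 : 0 ≤ L / n := div_nonneg h.L_nonneg (Nat.cast_nonneg _)
          gcongr
          exact h4.trans (by gcongr)
  have hlim : Tendsto (fun n : ℕ => (L / n * B + ∑ j, dev (a n) (K j n)) /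
      (1 - Real.exp (-σ)) ^ 2) atTop (𝓝 0) := by
    have h1 := (tendsto_const_div_atTop_nhds_zero_nat L).mul_const B
    have h2 := tendsto_finsetSum Finset.univ fun j _ => h.tendsto_dev_jump j
    have := (h1.add h2).div_const ((1 - Real.exp (-σ)) ^ 2)
    simpa using this
  refine squeeze_zero' (Eventually.of_forall fun n => Finset.sum_nonneg fun k _ => abs_nonneg _)
    ?_ hlim
  filter_upwards [eventually_gt_atTop 0] with n hn using hbound n hn

end StepArray

theorem tendsto_prod_one_add {ι : Type*} {s : ℕ → Finset ι} {e : ℕ → ι → ℝ}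
    (h : Tendsto (fun n => ∑ k ∈ s n, |e n k|) atTop (𝓝 0)) :
    Tendsto (fun n => ∏ k ∈ s n, (1 + e n k)) atTop (𝓝 1) := by
  rw [tendsto_iff_norm_sub_tendsto_zero]
  have h1 : Tendsto (fun n => Real.exp (∑ k ∈ s n, |e n k|) - 1) atTop (𝓝 0) := by
    have := (Real.continuous_exp.tendsto 0).comp h
    have := this.sub_const 1
    simpa using this
  exact squeeze_zero (fun n => norm_nonneg _)
    (fun n => (s n).norm_prod_one_add_sub_one_le (e n)) h1

namespace StepArray

variable {r : ℕ} {a : ℕ → ℕ → ℝ} {K : Fin r → ℕ → ℕ} {σ L : ℝ}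

/-- The error factor between the determinant and its leading-order form tends to `1`. -/
theorem tendsto_error (h : StepArray a K σ L) :
    Tendsto (fun n => (∏ k ∈ Finset.range n, (1 + defect (a n) k)) *
      ((1 - Real.exp (-a n n) * Real.exp (-a n n)) /
        (1 - ratio (a n) n * Real.exp (-a n n)))) atTop (𝓝 1) := by
  have hs := exp_neg_lt_one h.σ_pos
  have hρ : 0 < 1 - Real.exp (-σ) := by linarith
  have h1 := tendsto_prod_one_add h.tendsto_sum_defect
  have h2 : Tendsto (fun n => (1 - Real.exp (-a n n) * Real.exp (-a n n)) /
        (1 - ratio (a n) n * Real.exp (-a n n))) atTop (𝓝 1) := by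
    rw [tendsto_iff_norm_sub_tendsto_zero]
    have h3 := h.tendsto_dev_last.div_const (1 - Real.exp (-σ))
    rw [zero_div] at h3
    refine squeeze_zero (fun n => norm_nonneg _) (fun n => ?_) h3
    have hr := ratio_mem (a n) n
    have hm : Real.exp (-a n n) ≤ Real.exp (-σ) := Real.exp_le_exp.2 (neg_le_neg (h.le _ _))
    have hp := Real.exp_pos (-a n n)
    have hd : 1 - Real.exp (-σ) ≤ 1 - ratio (a n) n * Real.exp (-a n n) := by nlinarith
    have hd0 : 0 < 1 - ratio (a n) n * Real.exp (-a n n) := by linarith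
    rw [div_sub_one hd0.ne', norm_div, Real.norm_eq_abs, Real.norm_eq_abs, abs_of_pos hd0]
    have : 1 - Real.exp (-a n n) * Real.exp (-a n n) - (1 - ratio (a n) n * Real.exp (-a n n)) =
        (ratio (a n) n - Real.exp (-a n n)) * Real.exp (-a n n) := by ring
    rw [this, abs_mul, abs_of_pos hp]
    refine div_le_div₀ (dev_nonneg _ _) ?_ hρ hd
    exact mul_le_of_le_one_right (abs_nonneg _) (by linarith)
  simpa using h1.mul h2

end StepArray

/-! ### The substitution `y = 2 cosh x` and the constants in these coordinates -/

/-- The logarithm of the larger root of `z + 1 / z = y`. -/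
def logRoot (y : ℝ) : ℝ := Real.log ((y + √(y ^ 2 - 4)) / 2)

section LogRoot

variable {y : ℝ}

theorem sq_sub_four_pos (hy : 2 < y) : 0 < y ^ 2 - 4 := by nlinarith

theorem exp_logRoot (hy : 2 < y) : Real.exp (logRoot y) = (y + √(y ^ 2 - 4)) / 2 := by
  have := Real.sqrt_nonneg (y ^ 2 - 4)
  exact Real.exp_log (by linarith)

theorem exp_neg_logRoot (hy : 2 < y) : Real.exp (-logRoot y) = (y - √(y ^ 2 - 4)) / 2 := by
  have h0 := Real.sqrt_nonneg (y ^ 2 - 4)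
  have h1 := Real.sq_sqrt (sq_sub_four_pos hy).le
  rw [Real.exp_neg, exp_logRoot hy]
  refine inv_eq_of_mul_eq_one_right ?_
  nlinarith

theorem exp_logRoot_add (hy : 2 < y) :
    Real.exp (logRoot y) + Real.exp (-logRoot y) = y := by
  rw [exp_logRoot hy, exp_neg_logRoot hy]; ring

theorem wt_logRoot (hy : 2 < y) : wt (logRoot y) = √(y ^ 2 - 4) := by
  rw [wt, exp_logRoot hy, exp_neg_logRoot hy]; ring

theorem logRoot_pos (hy : 2 < y) : 0 < logRoot y := by
  have := Real.sqrt_nonneg (y ^ 2 - 4)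
  exact Real.log_pos (by linarith)

theorem logRoot_mono {x : ℝ} (hx : 2 < x) (h : x ≤ y) : logRoot x ≤ logRoot y := by
  have := Real.sqrt_nonneg (x ^ 2 - 4)
  refine Real.log_le_log (by linarith) ?_
  gcongr

theorem hasDerivAt_logRoot (hy : 2 < y) : HasDerivAt logRoot (1 / √(y ^ 2 - 4)) y := by
  have h0 := sq_sub_four_pos hy
  have hs := Real.sqrt_pos.2 h0
  have h1 : HasDerivAt (fun y : ℝ => y ^ 2 - 4) (2 * y) y := by
    simpa using (hasDerivAt_pow 2 y).sub_const 4
  have h2 := (((hasDerivAt_id y).add (h1.sqrt h0.ne')).div_const 2).log (by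
    simp only [Pi.add_apply, id]; positivity)
  refine h2.congr_deriv ?_
  simp only [Pi.add_apply, id]
  have : y + √(y ^ 2 - 4) ≠ 0 := by positivity
  field_simp
  ring

theorem continuousAt_logRoot (hy : 2 < y) : ContinuousAt logRoot y :=
  (hasDerivAt_logRoot hy).continuousAt

theorem beta_eq {l u : ℝ} (hl : 2 < l) (hu : 2 < u) :
    beta l u = hbeta (logRoot l) (logRoot u) := by
  have h1 := sq_sub_four_pos hl
  have h2 := sq_sub_four_pos hu
  have h3 : ((u ^ 2 - 4) * (l ^ 2 - 4)) ^ (1 / 4 : ℝ) = √(√(l ^ 2 - 4) * √(u ^ 2 - 4)) := by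
    rw [← Real.sqrt_mul h1.le, mul_comm, Real.sqrt_eq_rpow, Real.sqrt_eq_rpow, ← Real.rpow_mul
      (mul_pos h1 h2).le]
    norm_num
  have h4 : √(√(l ^ 2 - 4) * √(u ^ 2 - 4)) ≠ 0 := by positivity
  rw [beta, hbeta, wt_logRoot hl, wt_logRoot hu, exp_logRoot hl, exp_neg_logRoot hu, h3]
  field_simp
  ring

theorem gamma_rpow {l u : ℝ} (hl : 2 < l) (hu : 2 < u) (t : ℝ) :
    gamma l u ^ t = Real.exp (t * (logRoot u - logRoot l)) := by
  have h : gamma l u = Real.exp (logRoot u - logRoot l) := by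
    have := Real.sqrt_nonneg (l ^ 2 - 4)
    have : l + √(l ^ 2 - 4) ≠ 0 := by positivity
    rw [Real.exp_sub, exp_logRoot hl, exp_logRoot hu, gamma]
    field_simp
  rw [h, ← Real.exp_mul, mul_comm]

/-- The right side is the prefactor of the product formula; the bracket is the factor on its left
side with `ratio` replaced by its limiting root. -/
theorem alpha_eq {l u : ℝ} (hl : 2 < l) (hu : 2 < u) :
    alpha l u * (1 - Real.exp (-logRoot u) * Real.exp (-logRoot u)) =
      √(wt (logRoot u) / wt (logRoot l)) := by
  have h1 := sq_sub_four_pos hl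
  have h2 := sq_sub_four_pos hu
  have h3 : ((l ^ 2 - 4) * (u ^ 2 - 4)) ^ (1 / 4 : ℝ) = √(√(l ^ 2 - 4) * √(u ^ 2 - 4)) := by
    rw [← Real.sqrt_mul h1.le, Real.sqrt_eq_rpow, Real.sqrt_eq_rpow, ← Real.rpow_mul
      (mul_pos h1 h2).le]
    norm_num
  have h4 : Real.exp (logRoot u) * (1 - Real.exp (-logRoot u) * Real.exp (-logRoot u)) =
      √(u ^ 2 - 4) := by
    have : Real.exp (logRoot u) * Real.exp (-logRoot u) = 1 := by rw [← Real.exp_add]; simp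
    rw [← wt_logRoot hu, wt]
    linear_combination (-Real.exp (-logRoot u)) * this
  have h5 : alpha l u = Real.exp (logRoot u) / √(√(l ^ 2 - 4) * √(u ^ 2 - 4)) := by
    rw [alpha, h3, exp_logRoot hu]; ring
  have h6 : 0 < √(l ^ 2 - 4) := Real.sqrt_pos.2 h1
  have h7 : 0 < √(u ^ 2 - 4) := Real.sqrt_pos.2 h2
  rw [h5, div_mul_eq_mul_div, h4, wt_logRoot hl, wt_logRoot hu, Real.sqrt_div h7.le,
    Real.sqrt_mul h6.le]
  have h8 := Real.sq_sqrt h7.le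
  have h9 := Real.sqrt_pos.2 h6
  have h10 := Real.sqrt_pos.2 h7
  rw [div_eq_div_iff (by positivity) (by positivity)]
  linear_combination (-√√(l ^ 2 - 4)) * h8

end LogRoot

/-! ### Estimates on smooth cells -/

/-- Up to a quadratic error, `hbeta x y` is `exp ((x - y) / 2)`. -/
theorem abs_log_hbeta_le {σ x y : ℝ} (hσ : 0 < σ) (hx : σ ≤ x) (hy : σ ≤ y) :
    |Real.log (hbeta x y) - (x - y) / 2| ≤ (x - y) ^ 2 / (1 - Real.exp (-σ)) ^ 2 := by
  have hx0 := hσ.trans_le hx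
  have hy0 := hσ.trans_le hy
  set m := Real.exp (-x) with hm
  set m' := Real.exp (-y) with hm'
  have hs := exp_neg_lt_one hσ
  have h1 : m ≤ Real.exp (-σ) := Real.exp_le_exp.2 (by linarith)
  have h2 : m' ≤ Real.exp (-σ) := Real.exp_le_exp.2 (by linarith)
  have hmp : 0 < m := Real.exp_pos _
  have hmp' : 0 < m' := Real.exp_pos _
  have hd1 : 1 - Real.exp (-σ) ≤ 1 - m ^ 2 := by nlinarith
  have hd2 : 1 - Real.exp (-σ) ≤ 1 - m' ^ 2 := by nlinarith
  have hd0 : 0 < 1 - Real.exp (-σ) := by linarith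
  set q := (m - m') ^ 2 / ((1 - m ^ 2) * (1 - m' ^ 2)) with hq
  have hd3 : 0 < 1 - m ^ 2 := by linarith
  have hd4 : 0 < 1 - m' ^ 2 := by linarith
  have hq0 : 0 ≤ q := by positivity
  have hqle : q ≤ (x - y) ^ 2 / (1 - Real.exp (-σ)) ^ 2 := by
    rw [hq, sq (1 - Real.exp (-σ))]
    have : (m - m') ^ 2 ≤ (x - y) ^ 2 := sq_le_sq.2 (abs_exp_neg_sub_le hx0.le hy0.le)
    gcongr
  -- Squaring isolates the symmetric correction `1 + q`, and `0 ≤ log (1 + q) ≤ q` is quadratic in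
  -- `x - y`.
  have hsq : hbeta x y ^ 2 = Real.exp (x - y) * (1 + q) := by
    have hex : Real.exp x = 1 / m := by rw [hm, Real.exp_neg]; simp
    have hey : Real.exp y = 1 / m' := by rw [hm', Real.exp_neg]; simp
    have hwx : wt x = (1 - m ^ 2) / m := by rw [wt, hex, ← hm]; field_simp
    have hwy : wt y = (1 - m' ^ 2) / m' := by rw [wt, hey, ← hm']; field_simp
    rw [hbeta, div_pow, Real.sq_sqrt (mul_pos (wt_pos hx0) (wt_pos hy0)).le, hwx, hwy,
      Real.exp_sub, hex, hey, ← hm', hq]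
    field_simp
    ring
  have hlog : 2 * Real.log (hbeta x y) = (x - y) + Real.log (1 + q) := by
    have := congrArg Real.log hsq
    rwa [Real.log_pow, Real.log_mul (Real.exp_pos _).ne' (by positivity), Real.log_exp] at this
  have hl1 : Real.log (1 + q) ≤ q := by
    have := Real.log_le_sub_one_of_pos (show 0 < 1 + q by positivity)
    linarith
  have hl0 : 0 ≤ Real.log (1 + q) := Real.log_nonneg (by linarith)
  have : Real.log (hbeta x y) - (x - y) / 2 = Real.log (1 + q) / 2 := by linarith
  rw [this, abs_of_nonneg (by positivity)]
  linarith

/-- Three applications of the mean value theorem, so that `g₂` need be neither continuous nor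
integrable. The constant is not optimised. -/
theorem abs_integral_sub_trapezoid_le {g g₁ g₂ : ℝ → ℝ} {a b M : ℝ} (hab : a < b)
    (hg : ContinuousOn g (Set.Icc a b)) (h1 : ∀ x ∈ Set.Ioo a b, HasDerivAt g (g₁ x) x)
    (h2 : ∀ x ∈ Set.Ioo a b, HasDerivAt g₁ (g₂ x) x) (hM : ∀ x ∈ Set.Ioo a b, |g₂ x| ≤ M) :
    |(∫ x in a..b, g x) - (b - a) * (g a + g b) / 2| ≤ M * (b - a) ^ 3 := by
  set F : ℝ → ℝ := fun x => (∫ t in a..x, g t) - (x - a) * (g a + g x) / 2 with hF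
  have hcont : ContinuousOn F (Set.Icc a b) := by
    have hi : ContinuousOn (fun x => ∫ t in a..x, g t) (Set.Icc a b) := by
      have := intervalIntegral.continuousOn_primitive_interval
        (μ := MeasureTheory.volume) (f := g) (a := a) (b := b)
        (by rw [Set.uIcc_of_le hab.le]; exact hg.integrableOn_Icc)
      rwa [Set.uIcc_of_le hab.le] at this
    exact hi.sub ((((continuousOn_id.sub continuousOn_const).mul
      (continuousOn_const.add hg)).div_const 2))
  have hder : ∀ x ∈ Set.Ioo a b,
      HasDerivAt F (g x - ((g a + g x) + (x - a) * g₁ x) / 2) x := by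
    intro x hx
    have hi : HasDerivAt (fun x => ∫ t in a..x, g t) (g x) x := by
      refine intervalIntegral.integral_hasDerivAt_right ?_ ?_ (h1 x hx).continuousAt
      · refine ContinuousOn.intervalIntegrable (hg.mono ?_)
        rw [Set.uIcc_of_le hx.1.le]
        exact Set.Icc_subset_Icc_right hx.2.le
      · exact ContinuousOn.stronglyMeasurableAtFilter isOpen_Ioo
          (hg.mono Set.Ioo_subset_Icc_self) x hx
    have := hi.sub ((((hasDerivAt_id x).sub_const a).mul
      ((h1 x hx).const_add (g a))).div_const 2)
    refine this.congr_deriv ?_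
    simp
  obtain ⟨c, hc, hceq⟩ := exists_hasDerivAt_eq_slope F _ hab hcont hder
  obtain ⟨d, hd, hdeq⟩ := exists_hasDerivAt_eq_slope g g₁ hc.1
    (hg.mono (Set.Icc_subset_Icc_right hc.2.le)) fun x hx => h1 x ⟨hx.1, hx.2.trans hc.2⟩
  obtain ⟨e, he, heeq⟩ := exists_hasDerivAt_eq_slope g₁ g₂ hd.2
    (fun x hx => (h2 x ⟨hd.1.trans_le hx.1, hx.2.trans_lt hc.2⟩).continuousAt.continuousWithinAt)
    fun x hx => h2 x ⟨hd.1.trans hx.1, hx.2.trans hc.2⟩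
  have hFa : F a = 0 := by simp [hF]
  have hFb : F b = (∫ x in a..b, g x) - (b - a) * (g a + g b) / 2 := rfl
  have hca : 0 < c - a := sub_pos.2 hc.1
  have hcd : 0 < c - d := sub_pos.2 hd.2
  have hba : 0 < b - a := sub_pos.2 hab
  rw [eq_div_iff hca.ne'] at hdeq
  rw [eq_div_iff hcd.ne'] at heeq
  rw [eq_div_iff hba.ne', hFa, sub_zero] at hceq
  -- `F'(c) = (g c - g a - (c - a) g₁ c) / 2 = (c - a) (g₁ d - g₁ c) / 2`, and `g₁ c - g₁ d = (c -
  -- d) g₂ e`.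
  have hval : F b = -((c - a) * (c - d) * (b - a) / 2) * g₂ e := by
    rw [← hceq]
    linear_combination (-(b - a) / 2) * hdeq + (c - a) * (b - a) / 2 * heeq
  rw [← hFb, hval, abs_mul, abs_neg, abs_of_pos (by positivity)]
  have hMe := hM e ⟨hd.1.trans he.1, he.2.trans hc.2⟩
  have hM0 : 0 ≤ M := (abs_nonneg _).trans hMe
  have h3 : (c - a) * (c - d) * (b - a) / 2 ≤ (b - a) ^ 3 := by
    have e1 : (c - a) * (c - d) ≤ (b - a) * (b - a) :=
      mul_le_mul (by linarith [hc.2]) (by linarith [hc.2, hd.1]) hcd.le hba.le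
    nlinarith [mul_le_mul_of_nonneg_right e1 hba.le, mul_pos hca hcd, pow_pos hba 3]
  calc _ ≤ (b - a) ^ 3 * M := mul_le_mul h3 hMe (abs_nonneg _) (by positivity)
    _ = _ := mul_comm _ _

/-- On a convex piece the mean value inequality applies. Near any point the set is covered by two
convex pieces, left and right of it, and possibly the point itself; compactness of `[0,1]` makes the
bound global. -/
theorem exists_abs_le_of_hasDerivWithinAt {C : Set ℝ} (hC : C.Finite) {h h₁ : ℝ → ℝ} {M : ℝ}
    (hd : ∀ x ∈ Set.Icc (0 : ℝ) 1 \ C,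
      HasDerivWithinAt h (h₁ x) (Set.Icc (0 : ℝ) 1 \ C) x ∧ |h₁ x| ≤ M) :
    ∃ B, ∀ x ∈ Set.Icc (0 : ℝ) 1 \ C, |h x| ≤ B := by
  have hconv : ∀ I ⊆ Set.Icc (0 : ℝ) 1 \ C, Convex ℝ I → ∃ B, ∀ x ∈ I, |h x| ≤ B := by
    intro I hI hI'
    obtain rfl | ⟨y, hy⟩ := I.eq_empty_or_nonempty
    · exact ⟨0, by simp⟩
    refine ⟨|h y| + M, fun x hx => ?_⟩
    have h1 := hI'.norm_image_sub_le_of_norm_hasDerivWithin_le (f := h) (f' := h₁) (C := M)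
      (fun z hz => (hd z (hI hz)).1.mono hI) (fun z hz => (hd z (hI hz)).2) hy hx
    have h2 : ‖x - y‖ ≤ 1 := by
      have := (hI hx).1
      have := (hI hy).1
      simp only [Set.mem_Icc] at *
      exact abs_le.2 ⟨by linarith, by linarith⟩
    have hM : 0 ≤ M := (abs_nonneg _).trans (hd y (hI hy)).2
    have h3 := h1.trans (mul_le_of_le_one_right hM h2)
    have h4 := norm_le_norm_add_norm_sub' (h x) (h y)
    simp only [Real.norm_eq_abs] at h3 h4
    linarith
  have hcpt := (isCompact_Icc (a := (0 : ℝ)) (b := 1)).induction_on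
    (p := fun s => ∃ B, ∀ x ∈ s ∩ (Set.Icc (0 : ℝ) 1 \ C), |h x| ≤ B)
    ⟨0, by simp⟩
    (fun s t hst ⟨B, hB⟩ => ⟨B, fun x hx => hB x ⟨hst hx.1, hx.2⟩⟩)
    (fun s t ⟨B, hB⟩ ⟨B', hB'⟩ => ⟨max B B', fun x hx => hx.1.elim
      (fun h => (hB x ⟨h, hx.2⟩).trans (le_max_left _ _))
      (fun h => (hB' x ⟨h, hx.2⟩).trans (le_max_right _ _))⟩)
    (fun x _ => by
      have hopen : (C \ {x})ᶜ ∈ 𝓝 x :=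
        (hC.subset Set.sdiff_subset).isClosed.isOpen_compl.mem_nhds (by simp)
      obtain ⟨δ, hδ, hball⟩ := Metric.mem_nhds_iff.1 hopen
      rw [Real.ball_eq_Ioo] at hball
      have hnC : ∀ z ∈ Set.Ioo (x - δ) (x + δ), z ≠ x → z ∉ C := fun z hz hzx hzC =>
        hball hz ⟨hzC, hzx⟩
      obtain ⟨B₁, hB₁⟩ := hconv (Set.Ioo (x - δ) x ∩ Set.Icc 0 1)
        (fun z hz => ⟨hz.2, hnC z ⟨hz.1.1, by linarith [hz.1.2]⟩ hz.1.2.ne⟩)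
        ((convex_Ioo _ _).inter (convex_Icc _ _))
      obtain ⟨B₂, hB₂⟩ := hconv (Set.Ioo x (x + δ) ∩ Set.Icc 0 1)
        (fun z hz => ⟨hz.2, hnC z ⟨by linarith [hz.1.1], hz.1.2⟩ hz.1.1.ne'⟩)
        ((convex_Ioo _ _).inter (convex_Icc _ _))
      refine ⟨Set.Ioo (x - δ) (x + δ),
        mem_nhdsWithin_of_mem_nhds (Ioo_mem_nhds (by linarith) (by linarith)),
        max |h x| (max B₁ B₂), fun z hz => ?_⟩
      rcases lt_trichotomy z x with hzx | rfl | hzx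
      · exact (hB₁ z ⟨⟨hz.1.1, hzx⟩, hz.2.1⟩).trans
          ((le_max_left _ _).trans (le_max_right _ _))
      · exact le_max_left _ _
      · exact (hB₂ z ⟨⟨hzx, hz.1.2⟩, hz.2.1⟩).trans
          ((le_max_right _ _).trans (le_max_right _ _)))
  obtain ⟨B, hB⟩ := hcpt
  exact ⟨B, fun x hx => hB x ⟨hx.1, hx⟩⟩

/-- Lipschitz and trapezoidal bounds for `logRoot ∘ f` between consecutive discontinuities. -/
theorem exists_cell_bounds {C : Set ℝ} (hC : C.Finite) {f : ℝ → ℝ}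
    (hf : TwiceDiffBddOn f (Set.Icc (0 : ℝ) 1 \ C)) {ε : ℝ} (hε : 0 < ε)
    (hf2 : ∀ x ∈ Set.Icc (0 : ℝ) 1, 2 + ε < f x) :
    ∃ L M : ℝ, 0 ≤ L ∧ 0 ≤ M ∧ ∀ a b, 0 ≤ a → a < b → b ≤ 1 →
      Set.Ioo a b ⊆ Set.Icc (0 : ℝ) 1 \ C → ContinuousOn f (Set.Icc a b) →
      |logRoot (f b) - logRoot (f a)| ≤ L * (b - a) ∧
      |(∫ x in a..b, logRoot (f x)) - (b - a) * (logRoot (f a) + logRoot (f b)) / 2| ≤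
        M * (b - a) ^ 3 := by
  obtain ⟨f₁, f₂, M₂, hfd⟩ := hf
  -- The bound on the second derivative descends to the first derivative and then to `f`.
  obtain ⟨B₁, hB₁⟩ := exists_abs_le_of_hasDerivWithinAt hC (h := f₁) (h₁ := f₂) (M := M₂)
    fun x hx => (hfd x hx).2
  obtain ⟨B, hB⟩ := exists_abs_le_of_hasDerivWithinAt hC (h := f) (h₁ := f₁) (M := B₁)
    fun x hx => ⟨(hfd x hx).1, hB₁ x hx⟩
  set w := √((2 + ε) ^ 2 - 4) with hw
  have hw0 : 0 < w := Real.sqrt_pos.2 (by nlinarith)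
  -- Bounds for the first and second derivatives of `logRoot ∘ f`, namely `f' / s` and `f'' / s - f
  -- f'^2 / s^3` with `s = √(f^2 - 4) ≥ w`.
  refine ⟨|B₁| / w, |M₂| / w + |B| * |B₁| ^ 2 / w ^ 3, by positivity, by positivity, ?_⟩
  intro a b ha hab hb hsub hcont
  have hI : Set.Icc a b ⊆ Set.Icc 0 1 := Set.Icc_subset_Icc ha hb
  have h2 : ∀ x ∈ Set.Icc a b, 2 < f x := fun x hx => by linarith [hf2 x (hI hx)]
  have hnhds : ∀ x ∈ Set.Ioo a b, Set.Icc (0 : ℝ) 1 \ C ∈ 𝓝 x := fun x hx =>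
    Filter.mem_of_superset (isOpen_Ioo.mem_nhds hx) hsub
  have hg : ContinuousOn (fun x => logRoot (f x)) (Set.Icc a b) := fun x hx =>
    ContinuousAt.comp_continuousWithinAt (g := logRoot) (continuousAt_logRoot (h2 x hx)) (hcont x hx)
  have hwle : ∀ x ∈ Set.Ioo a b, w ≤ √(f x ^ 2 - 4) := fun x hx => by
    have := hf2 x (hI (Set.Ioo_subset_Icc_self hx))
    refine Real.sqrt_le_sqrt ?_
    nlinarith
  have hfder : ∀ x ∈ Set.Ioo a b, HasDerivAt f (f₁ x) x := fun x hx =>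
    (hfd x (hsub hx)).1.hasDerivAt (hnhds x hx)
  have hf1der : ∀ x ∈ Set.Ioo a b, HasDerivAt f₁ (f₂ x) x := fun x hx =>
    (hfd x (hsub hx)).2.1.hasDerivAt (hnhds x hx)
  have hg1 : ∀ x ∈ Set.Ioo a b,
      HasDerivAt (fun x => logRoot (f x)) (f₁ x / √(f x ^ 2 - 4)) x := by
    intro x hx
    have := (hasDerivAt_logRoot (h2 x (Set.Ioo_subset_Icc_self hx))).comp x (hfder x hx)
    refine this.congr_deriv ?_
    ring
  have hg2 : ∀ x ∈ Set.Ioo a b, HasDerivAt (fun x => f₁ x / √(f x ^ 2 - 4))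
      (f₂ x / √(f x ^ 2 - 4) - f x * f₁ x ^ 2 / √(f x ^ 2 - 4) ^ 3) x := by
    intro x hx
    have h0 := sq_sub_four_pos (h2 x (Set.Ioo_subset_Icc_self hx))
    have hs := Real.sqrt_pos.2 h0
    have h3 := (((hfder x hx).pow 2).sub_const 4).sqrt h0.ne'
    have h4 := (hf1der x hx).div h3 hs.ne'
    refine h4.congr_deriv ?_
    simp only [Pi.pow_apply]
    field_simp
    simp only [Nat.cast_ofNat, Nat.add_one_sub_one, pow_one]
    ring
  constructor
  · obtain ⟨z, hz, hzeq⟩ := exists_hasDerivAt_eq_slope _ _ hab hg hg1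
    have hba : 0 < b - a := sub_pos.2 hab
    rw [eq_div_iff hba.ne'] at hzeq
    rw [← hzeq, abs_mul, abs_of_pos hba, abs_div]
    have := hwle z hz
    have h3 := (hB₁ z (hsub hz)).trans (le_abs_self B₁)
    gcongr
    exact this.trans (le_abs_self _)
  · refine abs_integral_sub_trapezoid_le hab hg hg1 hg2 fun x hx => ?_
    have h3 := hwle x hx
    have h4 := (hB₁ x (hsub hx)).trans (le_abs_self B₁)
    have h5 := (hB x (hsub hx)).trans (le_abs_self B)
    have h6 := (hfd x (hsub hx)).2.2.trans (le_abs_self M₂)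
    refine (abs_sub _ _).trans ?_
    rw [abs_div, abs_div, abs_mul, abs_pow, abs_pow, abs_of_nonneg (Real.sqrt_nonneg _)]
    gcongr

/-! ### Position of the jumps relative to the grid -/

/-- The standing hypotheses: `f` is right-continuous at the `c j` with `j ∈ R` and left-continuous
at the others. -/
structure PiecewiseSmooth {r : ℕ} (c : Fin r → ℝ) (f : ℝ → ℝ) (fm fp : Fin r → ℝ) (ε : ℝ)
    (R : Finset (Fin r)) : Prop where
  inj : Function.Injective c
  mem : ∀ j, c j ∈ Set.Ioo (0 : ℝ) 1
  smooth : TwiceDiffBddOn f (Set.Icc (0 : ℝ) 1 \ Set.range c)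
  lim_left : ∀ j, Tendsto f (𝓝[<] (c j)) (𝓝 (fm j))
  lim_right : ∀ j, Tendsto f (𝓝[>] (c j)) (𝓝 (fp j))
  ε_pos : 0 < ε
  gt : ∀ x ∈ Set.Icc (0 : ℝ) 1, 2 + ε < f x
  eq_right : ∀ j ∈ R, f (c j) = fp j
  eq_left : ∀ j ∉ R, f (c j) = fm j

/-- The index of the grid cell in which the jump at `c j` occurs. -/
def jumpIndex {r : ℕ} (c : Fin r → ℝ) (R : Finset (Fin r)) (j : Fin r) (n : ℕ) : ℕ :=
  if j ∈ R then ⌈(n : ℝ) * c j⌉₊ - 1 else ⌊(n : ℝ) * c j⌋₊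

/-- The values of `logRoot ∘ f` at the grid points, continued by a constant. -/
def gridRoot (f : ℝ → ℝ) (n k : ℕ) : ℝ := logRoot (f ((min k n : ℕ) / (n : ℝ)))

/-- The contribution of the `k`-th grid cell to `D n f / G f ^ n`. -/
def cellFactor (f : ℝ → ℝ) (n k : ℕ) : ℝ :=
  Real.exp (gridRoot f n (k + 1)) * hbeta (gridRoot f n k) (gridRoot f n (k + 1)) *
    Real.exp (-(n * ∫ x in (k / n : ℝ)..((k + 1 : ℕ) / n : ℝ), logRoot (f x)))

theorem eventually_lt_natCast_mul (B : ℝ) {δ : ℝ} (hδ : 0 < δ) : ∀ᶠ n : ℕ in atTop, B < n * δ :=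
  (tendsto_natCast_atTop_atTop.atTop_mul_const hδ).eventually_gt_atTop B

/-- Serves for the two parts of a jump cell, where the integrand approaches a one-sided limit.
Closeness is asked only on the open interval, since the value at the jump may differ from that
limit. -/
theorem tendsto_mul_integral_sub {g : ℝ → ℝ} {p q : ℕ → ℝ} {l : ℝ} (hpq : ∀ᶠ n in atTop, p n ≤ q n)
    (hle : ∀ᶠ n : ℕ in atTop, n * (q n - p n) ≤ 1)
    (hint : ∀ᶠ n in atTop, IntervalIntegrable g MeasureTheory.volume (p n) (q n))
    (hg : ∀ δ > 0, ∀ᶠ n in atTop, ∀ x ∈ Set.Ioo (p n) (q n), |g x - l| ≤ δ) :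
    Tendsto (fun n : ℕ => n * (∫ x in (p n)..(q n), g x) - n * (q n - p n) * l) atTop (𝓝 0) := by
  rw [Metric.tendsto_nhds]
  intro δ hδ
  filter_upwards [hpq, hle, hint, hg (δ / 2) (half_pos hδ)] with n h1 h2 h3 h4
  have h5 : (∫ x in (p n)..(q n), g x) - (q n - p n) * l = ∫ x in (p n)..(q n), (g x - l) := by
    rw [intervalIntegral.integral_sub h3 intervalIntegrable_const,
      intervalIntegral.integral_const, smul_eq_mul]
  have h6 : ‖∫ x in (p n)..(q n), (g x - l)‖ ≤ δ / 2 * |q n - p n| := by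
    refine intervalIntegral.norm_integral_le_of_norm_le_const_ae ?_
    filter_upwards [MeasureTheory.Measure.ae_ne MeasureTheory.volume (q n)] with x hx hx'
    rw [Set.uIoc_of_le h1] at hx'
    exact h4 x ⟨hx'.1, lt_of_le_of_ne hx'.2 hx⟩
  rw [abs_of_nonneg (by linarith)] at h6
  have h7 : (n : ℝ) * (∫ x in (p n)..(q n), g x) - n * (q n - p n) * l =
      n * ∫ x in (p n)..(q n), (g x - l) := by rw [← h5]; ring
  rw [h7, dist_zero_right, norm_mul, Real.norm_natCast]
  calc (n : ℝ) * _ ≤ n * (δ / 2 * (q n - p n)) := by gcongr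
    _ = δ / 2 * (n * (q n - p n)) := by ring
    _ ≤ δ / 2 * 1 := by gcongr
    _ < δ := by linarith

/-- The grid point may coincide with `c` for some `n` and not for others. If `f c = l`, left
continuity covers both cases; otherwise coincidence is eventually excluded. -/
theorem tendsto_of_le_of_eq_imp {f : ℝ → ℝ} {c l : ℝ} (hf : Tendsto f (𝓝[<] c) (𝓝 l))
    {u : ℕ → ℝ} (hu : Tendsto u atTop (𝓝 c)) (hle : ∀ᶠ n in atTop, u n ≤ c)
    (heq : ∀ᶠ n in atTop, u n = c → f c = l) : Tendsto (fun n => f (u n)) atTop (𝓝 l) := by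
  by_cases h : f c = l
  · have h1 : ContinuousWithinAt f (Set.Iic c) c := by
      rw [← continuousWithinAt_Iio_iff_Iic, ContinuousWithinAt, h]; exact hf
    rw [ContinuousWithinAt, h] at h1
    exact h1.comp (tendsto_nhdsWithin_iff.2 ⟨hu, hle⟩)
  · refine hf.comp (tendsto_nhdsWithin_iff.2 ⟨hu, ?_⟩)
    filter_upwards [hle, heq] with n h1 h2
    exact lt_of_le_of_ne h1 fun h3 => h (h2 h3)

theorem tendsto_of_ge_of_eq_imp {f : ℝ → ℝ} {c l : ℝ} (hf : Tendsto f (𝓝[>] c) (𝓝 l))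
    {u : ℕ → ℝ} (hu : Tendsto u atTop (𝓝 c)) (hle : ∀ᶠ n in atTop, c ≤ u n)
    (heq : ∀ᶠ n in atTop, u n = c → f c = l) : Tendsto (fun n => f (u n)) atTop (𝓝 l) := by
  by_cases h : f c = l
  · have h1 : ContinuousWithinAt f (Set.Ici c) c := by
      rw [← continuousWithinAt_Ioi_iff_Ici, ContinuousWithinAt, h]; exact hf
    rw [ContinuousWithinAt, h] at h1
    exact h1.comp (tendsto_nhdsWithin_iff.2 ⟨hu, hle⟩)
  · refine hf.comp (tendsto_nhdsWithin_iff.2 ⟨hu, ?_⟩)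
    filter_upwards [hle, heq] with n h1 h2
    exact lt_of_le_of_ne h1 fun h3 => h (h2 h3.symm)

theorem tendsto_hbeta {u v : ℕ → ℝ} {x y : ℝ} (hx : 0 < x) (hy : 0 < y)
    (hu : Tendsto u atTop (𝓝 x)) (hv : Tendsto v atTop (𝓝 y)) :
    Tendsto (fun n => hbeta (u n) (v n)) atTop (𝓝 (hbeta x y)) := by
  have h1 : ∀ {u : ℕ → ℝ} {x : ℝ}, Tendsto u atTop (𝓝 x) →
      Tendsto (fun n => Real.exp (u n)) atTop (𝓝 (Real.exp x)) := fun h =>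
    (Real.continuous_exp.tendsto _).comp h
  have h2 : Tendsto (fun n => wt (u n) * wt (v n)) atTop (𝓝 (wt x * wt y)) :=
    ((h1 hu).sub (h1 hu.neg)).mul ((h1 hv).sub (h1 hv.neg))
  exact ((h1 hu).sub (h1 hv.neg)).div ((Real.continuous_sqrt.tendsto _).comp h2)
    (Real.sqrt_pos.2 (mul_pos (wt_pos hx) (wt_pos hy))).ne'

namespace PiecewiseSmooth

variable {r : ℕ} {c : Fin r → ℝ} {f : ℝ → ℝ} {fm fp : Fin r → ℝ} {ε : ℝ} {R : Finset (Fin r)}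

/-- The equality clause here and in `le_jumpIndex` settles the case of integral `n * c j`: the jump
cell starts at `c j` when `f` takes its left limit there, and ends at `c j` when it takes its right
limit. This is the origin of the two fractional parts. -/
theorem jumpIndex_le (h : PiecewiseSmooth c f fm fp ε R) (j : Fin r) {n : ℕ} (hn : 0 < n) :
    (jumpIndex c R j n : ℝ) ≤ n * c j ∧ (jumpIndex c R j n = (n : ℝ) * c j → j ∉ R) := by
  have hpos : 0 < (n : ℝ) * c j := mul_pos (by positivity) (h.mem j).1
  unfold jumpIndex
  split_ifs with hj
  · have h1 : 1 ≤ ⌈(n : ℝ) * c j⌉₊ := Nat.one_le_iff_ne_zero.2 (Nat.ceil_pos.2 hpos).ne'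
    have h2 := Nat.ceil_lt_add_one hpos.le
    rw [Nat.cast_sub h1, Nat.cast_one]
    exact ⟨by linarith, fun h3 => absurd h3 (by linarith)⟩
  · exact ⟨Nat.floor_le hpos.le, fun _ => hj⟩

theorem le_jumpIndex (h : PiecewiseSmooth c f fm fp ε R) (j : Fin r) {n : ℕ} (hn : 0 < n) :
    (n : ℝ) * c j ≤ jumpIndex c R j n + 1 ∧
      (jumpIndex c R j n + 1 = (n : ℝ) * c j → j ∈ R) := by
  have hpos : 0 < (n : ℝ) * c j := mul_pos (by positivity) (h.mem j).1
  unfold jumpIndex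
  split_ifs with hj
  · have h1 : 1 ≤ ⌈(n : ℝ) * c j⌉₊ := Nat.one_le_iff_ne_zero.2 (Nat.ceil_pos.2 hpos).ne'
    have h2 := Nat.le_ceil ((n : ℝ) * c j)
    rw [Nat.cast_sub h1, Nat.cast_one]
    exact ⟨by linarith, fun _ => hj⟩
  · have h2 := Nat.lt_floor_add_one ((n : ℝ) * c j)
    exact ⟨h2.le, fun h3 => absurd h3 (by linarith)⟩

theorem jumpIndex_lt (h : PiecewiseSmooth c f fm fp ε R) (j : Fin r) {n : ℕ} (hn : 0 < n) :
    jumpIndex c R j n < n := by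
  have h1 := (h.jumpIndex_le j hn).1
  have h2 := (h.mem j).2
  have h3 : (0 : ℝ) < n := by positivity
  have : (jumpIndex c R j n : ℝ) < n := by nlinarith
  exact_mod_cast this

theorem exponent_eq (h : PiecewiseSmooth c f fm fp ε R) (j : Fin r) {n : ℕ} (hn : 0 < n) :
    (if j ∈ R then fract' ((n : ℝ) * c j) else Int.fract ((n : ℝ) * c j)) =
      n * c j - jumpIndex c R j n := by
  have hpos : 0 < (n : ℝ) * c j := mul_pos (by positivity) (h.mem j).1
  unfold jumpIndex
  split_ifs with hj
  · have h1 : 1 ≤ ⌈(n : ℝ) * c j⌉₊ := Nat.one_le_iff_ne_zero.2 (Nat.ceil_pos.2 hpos).ne'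
    rw [Nat.cast_sub h1, Nat.cast_one, natCast_ceil_eq_intCast_ceil hpos.le, fract']
    ring
  · rw [natCast_floor_eq_intCast_floor hpos.le, Int.fract]

theorem eventually_far (h : PiecewiseSmooth c f fm fp ε R) (N : ℕ) {j j' : Fin r} (hj : j ≠ j') :
    ∀ᶠ n in atTop, jumpIndex c R j n + N < jumpIndex c R j' n ∨
      jumpIndex c R j' n + N < jumpIndex c R j n := by
  have hne : 0 < |c j - c j'| := abs_pos.2 (sub_ne_zero.2 (h.inj.ne hj))
  filter_upwards [eventually_lt_natCast_mul (N + 2) hne, eventually_gt_atTop 0] with n h1 hn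
  have a1 := (h.jumpIndex_le j hn).1
  have a2 := (h.le_jumpIndex j hn).1
  have b1 := (h.jumpIndex_le j' hn).1
  have b2 := (h.le_jumpIndex j' hn).1
  rcases le_total (c j) (c j') with hle | hle
  · left
    rw [abs_of_nonpos (by linarith)] at h1
    have : (jumpIndex c R j n : ℝ) + N < jumpIndex c R j' n := by linarith
    exact_mod_cast this
  · right
    rw [abs_of_nonneg (by linarith)] at h1
    have : (jumpIndex c R j' n : ℝ) + N < jumpIndex c R j n := by linarith
    exact_mod_cast this

/-- A discontinuity meeting a closed cell other than its own jump cell sits at an endpoint, and the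
prescribed one-sided continuity is the one pointing into the cell. -/
theorem cell_regular (h : PiecewiseSmooth c f fm fp ε R) {n k : ℕ} (hk : k < n)
    (hK : ∀ j, jumpIndex c R j n ≠ k) :
    Set.Ioo (k / n : ℝ) ((k + 1 : ℕ) / n : ℝ) ⊆ Set.Icc (0 : ℝ) 1 \ Set.range c ∧
      ContinuousOn f (Set.Icc (k / n : ℝ) ((k + 1 : ℕ) / n : ℝ)) := by
  have hn : (0 : ℝ) < n := by
    have : 0 < n := by omega
    positivity
  have hR : ∀ j, (k : ℝ) ≤ n * c j → n * c j ≤ (k + 1 : ℕ) →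
      (j ∈ R ∧ n * c j = k) ∨ (j ∉ R ∧ n * c j = (k + 1 : ℕ)) := by
    intro j h1 h2
    have h3 := hK j
    have hpos : 0 < (n : ℝ) * c j := mul_pos hn (h.mem j).1
    unfold jumpIndex at h3
    split_ifs at h3 with hj
    · refine Or.inl ⟨hj, le_antisymm (not_lt.1 fun h4 => h3 ?_) h1⟩
      have : ⌈(n : ℝ) * c j⌉₊ = k + 1 := by
        rw [Nat.ceil_eq_iff (by omega)]
        exact ⟨by simpa using h4, h2⟩
      omega
    · refine Or.inr ⟨hj, le_antisymm h2 (not_lt.1 fun h4 => h3 ?_)⟩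
      rw [Nat.floor_eq_iff hpos.le]
      exact ⟨h1, by simpa using h4⟩
  have hab : (k / n : ℝ) < ((k + 1 : ℕ) / n : ℝ) := by gcongr; omega
  have h0 : (0 : ℝ) ≤ k / n := by positivity
  have h1 : ((k + 1 : ℕ) / n : ℝ) ≤ 1 := by
    rw [div_le_one hn]; exact_mod_cast hk
  have hsub : Set.Ioo (k / n : ℝ) ((k + 1 : ℕ) / n : ℝ) ⊆ Set.Icc (0 : ℝ) 1 \ Set.range c := by
    rintro x ⟨hx1, hx2⟩
    refine ⟨⟨by linarith, by linarith⟩, ?_⟩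
    rintro ⟨j, rfl⟩
    rw [div_lt_iff₀' hn] at hx1
    rw [lt_div_iff₀' hn] at hx2
    rcases hR j hx1.le hx2.le with ⟨-, h3⟩ | ⟨-, h3⟩ <;> linarith
  refine ⟨hsub, ?_⟩
  obtain ⟨f₁, f₂, M, hfd⟩ := h.smooth
  have hS : ∀ x ∈ Set.Icc (0 : ℝ) 1 \ Set.range c,
      ContinuousWithinAt f (Set.Ioo (k / n : ℝ) ((k + 1 : ℕ) / n : ℝ)) x := fun x hx =>
    (hfd x hx).1.continuousWithinAt.mono hsub
  set a := (k / n : ℝ) with ha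
  set b := ((k + 1 : ℕ) / n : ℝ) with hb
  have hcw : ∀ x ∈ Set.Icc a b, ContinuousWithinAt f (Set.Ioo a b) x := by
    intro x hx
    by_cases hxc : x ∈ Set.range c
    · obtain ⟨j, rfl⟩ := hxc
      have e1 := (div_le_iff₀' hn).1 hx.1
      have e2 := (le_div_iff₀' hn).1 hx.2
      rcases hR j e1 e2 with ⟨h2, h3⟩ | ⟨h2, h3⟩
      · have h4 : ContinuousWithinAt f (Set.Ioi (c j)) (c j) := by
          rw [ContinuousWithinAt, h.eq_right j h2]; exact h.lim_right j
        have h5 : a = c j := by rw [ha, ← h3]; field_simp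
        rw [h5]
        exact h4.mono Set.Ioo_subset_Ioi_self
      · have h4 : ContinuousWithinAt f (Set.Iio (c j)) (c j) := by
          rw [ContinuousWithinAt, h.eq_left j h2]; exact h.lim_left j
        have h5 : b = c j := by rw [hb, ← h3]; field_simp
        rw [h5]
        exact h4.mono Set.Ioo_subset_Iio_self
    · exact hS x ⟨⟨h0.trans hx.1, hx.2.trans h1⟩, hxc⟩
  intro x hx
  have h2 := (continuousWithinAt_insert_self.2 (hcw x hx))
  rcases eq_or_lt_of_le hx.1 with rfl | hx1
  · refine h2.mono_of_mem_nhdsWithin ?_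
    rw [Set.Ioo_insert_left hab]
    exact mem_nhdsWithin.2 ⟨Set.Iio b, isOpen_Iio, hab, fun y hy => ⟨hy.2.1, hy.1⟩⟩
  rcases eq_or_lt_of_le hx.2 with rfl | hx2
  · refine h2.mono_of_mem_nhdsWithin ?_
    rw [Set.Ioo_insert_right hab]
    exact mem_nhdsWithin.2 ⟨Set.Ioi a, isOpen_Ioi, hab, fun y hy => ⟨hy.1, hy.2.2⟩⟩
  · exact ((hcw x hx).continuousAt (Ioo_mem_nhds hx1 hx2)).continuousWithinAt

theorem grid_mem (n k : ℕ) : ((min k n : ℕ) / (n : ℝ)) ∈ Set.Icc (0 : ℝ) 1 :=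
  ⟨by positivity, div_le_one_of_le₀ (by exact_mod_cast min_le_right k n) (by positivity)⟩

theorem two_lt (h : PiecewiseSmooth c f fm fp ε R) {x : ℝ} (hx : x ∈ Set.Icc (0 : ℝ) 1) :
    2 < f x := by linarith [h.gt x hx, h.ε_pos]

theorem gridRoot_eq {n k : ℕ} (hk : k ≤ n) : gridRoot f n k = logRoot (f (k / n)) := by
  rw [gridRoot, min_eq_left hk]

theorem le_gridRoot (h : PiecewiseSmooth c f fm fp ε R) (n k : ℕ) :
    logRoot (2 + ε) ≤ gridRoot f n k :=
  logRoot_mono (by linarith [h.ε_pos]) (h.gt _ (grid_mem n k)).le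

theorem logRoot_gap_pos (h : PiecewiseSmooth c f fm fp ε R) : 0 < logRoot (2 + ε) :=
  logRoot_pos (by linarith [h.ε_pos])

theorem exists_cell (h : PiecewiseSmooth c f fm fp ε R) :
    ∃ L M : ℝ, 0 ≤ L ∧ 0 ≤ M ∧ ∀ n k, k < n → (∀ j, jumpIndex c R j n ≠ k) →
      |gridRoot f n (k + 1) - gridRoot f n k| ≤ L / n ∧
      |n * (∫ x in (k / n : ℝ)..((k + 1 : ℕ) / n : ℝ), logRoot (f x)) -
        (gridRoot f n k + gridRoot f n (k + 1)) / 2| ≤ M / n ^ 2 := by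
  obtain ⟨L, M, hL, hM, hcell⟩ := exists_cell_bounds (Set.finite_range c) h.smooth h.ε_pos h.gt
  refine ⟨L, M, hL, hM, fun n k hk hK => ?_⟩
  obtain ⟨h1, h2⟩ := h.cell_regular hk hK
  have hn : (0 : ℝ) < n := by
    have : 0 < n := by omega
    positivity
  have hab : (k / n : ℝ) < ((k + 1 : ℕ) / n : ℝ) := by gcongr; omega
  have hb : ((k + 1 : ℕ) / n : ℝ) ≤ 1 := by
    rw [div_le_one hn]; exact_mod_cast hk
  obtain ⟨h3, h4⟩ := hcell _ _ (by positivity) hab hb h1 h2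
  have hlen : ((k + 1 : ℕ) / n : ℝ) - k / n = 1 / n := by push_cast; ring
  rw [hlen] at h3 h4
  rw [gridRoot_eq hk.le, gridRoot_eq (show k + 1 ≤ n from hk)]
  refine ⟨by rwa [mul_one_div] at h3, ?_⟩
  set I := ∫ x in (k / n : ℝ)..((k + 1 : ℕ) / n : ℝ), logRoot (f x)
  set s := logRoot (f (k / n)) + logRoot (f ((k + 1 : ℕ) / n))
  have h5 : (n : ℝ) * I - s / 2 = n * (I - 1 / n * s / 2) := by field_simp
  rw [h5, abs_mul, abs_of_pos hn]
  calc (n : ℝ) * |I - 1 / n * s / 2| ≤ n * (M * (1 / n) ^ 3) := by gcongr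
    _ = M / n ^ 2 := by field_simp

theorem stepArray (h : PiecewiseSmooth c f fm fp ε R) :
    ∃ L, StepArray (gridRoot f) (jumpIndex c R) (logRoot (2 + ε)) L := by
  obtain ⟨L, M, hL, -, hcell⟩ := h.exists_cell
  refine ⟨L, h.logRoot_gap_pos, hL, h.le_gridRoot, fun n k hk hK => (hcell n k hk hK).1, ?_, ?_, ?_⟩
  · intro N j j'
    by_cases hj : j = j'
    · subst hj; simp
    · filter_upwards [h.eventually_far N hj] with n hn
      omega
  · intro N j
    filter_upwards [eventually_lt_natCast_mul (N + 1) (h.mem j).1, eventually_gt_atTop 0]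
      with n h1 hn
    have := (h.le_jumpIndex j hn).1
    have : (N : ℝ) ≤ jumpIndex c R j n := by linarith
    exact_mod_cast this
  · intro N j
    filter_upwards [eventually_lt_natCast_mul N (sub_pos.2 (h.mem j).2), eventually_gt_atTop 0]
      with n h1 hn
    have := (h.jumpIndex_le j hn).1
    have : (jumpIndex c R j n : ℝ) + N < n := by linarith
    exact_mod_cast this

theorem integrableOn (h : PiecewiseSmooth c f fm fp ε R) :
    MeasureTheory.IntegrableOn (fun x => logRoot (f x)) (Set.Icc 0 1) := by
  obtain ⟨f₁, f₂, M, hfd⟩ := h.smooth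
  have hfin := Set.finite_range c
  obtain ⟨B₁, hB₁⟩ := exists_abs_le_of_hasDerivWithinAt hfin (h := f₁) (h₁ := f₂) (M := M)
    fun x hx => (hfd x hx).2
  obtain ⟨B, hB⟩ := exists_abs_le_of_hasDerivWithinAt hfin (h := f) (h₁ := f₁) (M := B₁)
    fun x hx => ⟨(hfd x hx).1, hB₁ x hx⟩
  have hmeas : MeasurableSet (Set.Icc (0 : ℝ) 1 \ Set.range c) :=
    measurableSet_Icc.diff hfin.measurableSet
  have hcont : ContinuousOn (fun x => logRoot (f x)) (Set.Icc (0 : ℝ) 1 \ Set.range c) :=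
    fun x hx => ContinuousAt.comp_continuousWithinAt (g := logRoot)
      (continuousAt_logRoot (h.two_lt hx.1)) (hfd x hx).1.continuousWithinAt
  have hint : MeasureTheory.IntegrableOn (fun x => logRoot (f x))
      (Set.Icc (0 : ℝ) 1 \ Set.range c) := by
    refine MeasureTheory.IntegrableOn.of_bound
      ((MeasureTheory.measure_mono Set.sdiff_subset).trans_lt measure_Icc_lt_top)
      (hcont.aestronglyMeasurable hmeas) (logRoot B) ?_
    · refine (MeasureTheory.ae_restrict_iff' hmeas).2 (Eventually.of_forall fun x hx => ?_)
      have h2 := h.two_lt hx.1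
      rw [Real.norm_eq_abs, abs_of_pos (logRoot_pos h2)]
      exact logRoot_mono h2 ((le_abs_self _).trans (hB x hx))
  refine hint.congr_set_ae ?_
  exact (MeasureTheory.sdiff_null_ae_eq_self (hfin.measure_zero _)).symm

theorem intervalIntegrable (h : PiecewiseSmooth c f fm fp ε R) {a b : ℝ} (ha : 0 ≤ a) (hab : a ≤ b)
    (hb : b ≤ 1) : IntervalIntegrable (fun x => logRoot (f x)) MeasureTheory.volume a b :=
  (intervalIntegrable_iff_integrableOn_Icc_of_le hab).2
    (h.integrableOn.mono_set (Set.Icc_subset_Icc ha hb))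

/-! ### Values and integrals at a jump -/

theorem eventually_mem_Icc (h : PiecewiseSmooth c f fm fp ε R) (j : Fin r) :
    ∀ᶠ x in 𝓝 (c j), x ∈ Set.Icc (0 : ℝ) 1 :=
  Icc_mem_nhds (h.mem j).1 (h.mem j).2

theorem two_lt_left (h : PiecewiseSmooth c f fm fp ε R) (j : Fin r) : 2 < fm j := by
  have : 2 + ε ≤ fm j := ge_of_tendsto (h.lim_left j) (by
    filter_upwards [mem_nhdsWithin_of_mem_nhds (h.eventually_mem_Icc j)] with x hx
    exact (h.gt x hx).le)
  linarith [h.ε_pos]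

theorem two_lt_right (h : PiecewiseSmooth c f fm fp ε R) (j : Fin r) : 2 < fp j := by
  have : 2 + ε ≤ fp j := ge_of_tendsto (h.lim_right j) (by
    filter_upwards [mem_nhdsWithin_of_mem_nhds (h.eventually_mem_Icc j)] with x hx
    exact (h.gt x hx).le)
  linarith [h.ε_pos]

theorem tendsto_jumpIndex_div (h : PiecewiseSmooth c f fm fp ε R) (j : Fin r) :
    Tendsto (fun n : ℕ => (jumpIndex c R j n / n : ℝ)) atTop (𝓝 (c j)) := by
  have h1 : Tendsto (fun n : ℕ => c j - 1 / n) atTop (𝓝 (c j)) := by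
    simpa using (tendsto_const_div_atTop_nhds_zero_nat (1 : ℝ)).const_sub (c j)
  refine tendsto_of_tendsto_of_tendsto_of_le_of_le' h1 tendsto_const_nhds ?_ ?_
  all_goals
    filter_upwards [eventually_gt_atTop 0] with n hn
    have hn' : (0 : ℝ) < n := by positivity
  · rw [le_div_iff₀ hn', sub_mul, one_div_mul_cancel hn'.ne']
    linarith [(h.le_jumpIndex j hn).1]
  · rw [div_le_iff₀ hn']
    linarith [(h.jumpIndex_le j hn).1]

theorem tendsto_jumpIndex_succ_div (h : PiecewiseSmooth c f fm fp ε R) (j : Fin r) :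
    Tendsto (fun n : ℕ => ((jumpIndex c R j n + 1 : ℕ) / n : ℝ)) atTop (𝓝 (c j)) := by
  have h1 := (h.tendsto_jumpIndex_div j).add (tendsto_const_div_atTop_nhds_zero_nat (1 : ℝ))
  rw [add_zero] at h1
  refine h1.congr fun n => ?_
  push_cast
  ring

theorem jump_bounds (h : PiecewiseSmooth c f fm fp ε R) (j : Fin r) {n : ℕ} (hn : 0 < n) :
    (jumpIndex c R j n / n : ℝ) ≤ c j ∧ c j ≤ ((jumpIndex c R j n + 1 : ℕ) / n : ℝ) := by
  have hn' : (0 : ℝ) < n := by positivity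
  rw [div_le_iff₀' hn', le_div_iff₀' hn']
  push_cast
  exact ⟨(h.jumpIndex_le j hn).1, (h.le_jumpIndex j hn).1⟩

theorem tendsto_left_value (h : PiecewiseSmooth c f fm fp ε R) (j : Fin r) :
    Tendsto (fun n => gridRoot f n (jumpIndex c R j n)) atTop (𝓝 (logRoot (fm j))) := by
  have h1 : Tendsto (fun n : ℕ => f (jumpIndex c R j n / n : ℝ)) atTop (𝓝 (fm j)) := by
    refine tendsto_of_le_of_eq_imp (h.lim_left j) (h.tendsto_jumpIndex_div j) ?_ ?_
    · filter_upwards [eventually_gt_atTop 0] with n hn using (h.jump_bounds j hn).1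
    · filter_upwards [eventually_gt_atTop 0] with n hn heq
      have hn' : (0 : ℝ) < n := by positivity
      refine h.eq_left j ((h.jumpIndex_le j hn).2 ?_)
      rw [← heq]; field_simp
  refine ((continuousAt_logRoot (h.two_lt_left j)).tendsto.comp h1).congr' ?_
  filter_upwards [eventually_gt_atTop 0] with n hn
  rw [gridRoot_eq (h.jumpIndex_lt j hn).le]
  rfl

theorem tendsto_right_value (h : PiecewiseSmooth c f fm fp ε R) (j : Fin r) :
    Tendsto (fun n => gridRoot f n (jumpIndex c R j n + 1)) atTop (𝓝 (logRoot (fp j))) := by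
  have h1 : Tendsto (fun n : ℕ => f ((jumpIndex c R j n + 1 : ℕ) / n : ℝ)) atTop
      (𝓝 (fp j)) := by
    refine tendsto_of_ge_of_eq_imp (h.lim_right j) (h.tendsto_jumpIndex_succ_div j) ?_ ?_
    · filter_upwards [eventually_gt_atTop 0] with n hn using (h.jump_bounds j hn).2
    · filter_upwards [eventually_gt_atTop 0] with n hn heq
      have hn' : (0 : ℝ) < n := by positivity
      refine h.eq_right j ((h.le_jumpIndex j hn).2 ?_)
      rw [← heq]; push_cast; field_simp
  refine ((continuousAt_logRoot (h.two_lt_right j)).tendsto.comp h1).congr' ?_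
  filter_upwards [eventually_gt_atTop 0] with n hn
  rw [gridRoot_eq (show jumpIndex c R j n + 1 ≤ n from h.jumpIndex_lt j hn)]
  rfl

theorem tendsto_integral_left (h : PiecewiseSmooth c f fm fp ε R) (j : Fin r) :
    Tendsto (fun n : ℕ => n * (∫ x in (jumpIndex c R j n / n : ℝ)..(c j), logRoot (f x)) -
      n * (c j - jumpIndex c R j n / n) * logRoot (fm j)) atTop (𝓝 0) := by
  refine tendsto_mul_integral_sub (p := fun n : ℕ => (jumpIndex c R j n / n : ℝ))
    (q := fun _ => c j) ?_ ?_ ?_ fun δ hδ => ?_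
  · filter_upwards [eventually_gt_atTop 0] with n hn using (h.jump_bounds j hn).1
  · filter_upwards [eventually_gt_atTop 0] with n hn
    have hn' : (0 : ℝ) < n := by positivity
    rw [mul_sub, mul_div_cancel₀ _ hn'.ne']
    linarith [(h.le_jumpIndex j hn).1]
  · filter_upwards [eventually_gt_atTop 0] with n hn
    exact h.intervalIntegrable (by positivity) (h.jump_bounds j hn).1 (h.mem j).2.le
  · have h1 := (continuousAt_logRoot (h.two_lt_left j)).tendsto.comp (h.lim_left j)
    have h2 := (Metric.tendsto_nhds.1 h1) δ hδ
    obtain ⟨x₀, hx₀, hI⟩ := mem_nhdsLT_iff_exists_Ioo_subset.1 h2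
    filter_upwards [(h.tendsto_jumpIndex_div j).eventually_const_lt hx₀] with n hn x hx
    exact (hI ⟨hn.trans hx.1, hx.2⟩ : dist _ _ < δ).le

theorem tendsto_integral_right (h : PiecewiseSmooth c f fm fp ε R) (j : Fin r) :
    Tendsto (fun n : ℕ =>
      n * (∫ x in (c j)..((jumpIndex c R j n + 1 : ℕ) / n : ℝ), logRoot (f x)) -
        n * ((jumpIndex c R j n + 1 : ℕ) / n - c j) * logRoot (fp j)) atTop (𝓝 0) := by
  refine tendsto_mul_integral_sub (p := fun _ => c j)
    (q := fun n : ℕ => ((jumpIndex c R j n + 1 : ℕ) / n : ℝ)) ?_ ?_ ?_ fun δ hδ => ?_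
  · filter_upwards [eventually_gt_atTop 0] with n hn using (h.jump_bounds j hn).2
  · filter_upwards [eventually_gt_atTop 0] with n hn
    have hn' : (0 : ℝ) < n := by positivity
    rw [mul_sub, mul_div_cancel₀ _ hn'.ne']
    push_cast
    linarith [(h.jumpIndex_le j hn).1]
  · filter_upwards [eventually_gt_atTop 0] with n hn
    have hn' : (0 : ℝ) < n := by positivity
    refine h.intervalIntegrable (h.mem j).1.le (h.jump_bounds j hn).2 ?_
    rw [div_le_one hn']
    exact_mod_cast h.jumpIndex_lt j hn
  · have h1 := (continuousAt_logRoot (h.two_lt_right j)).tendsto.comp (h.lim_right j)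
    have h2 := (Metric.tendsto_nhds.1 h1) δ hδ
    obtain ⟨x₀, hx₀, hI⟩ := mem_nhdsGT_iff_exists_Ioo_subset.1 h2
    filter_upwards [(h.tendsto_jumpIndex_succ_div j).eventually_lt_const hx₀] with n hn x hx
    exact (hI ⟨hx.1, hx.2.trans hn⟩ : dist _ _ < δ).le

/-! ### Asymptotics of the cell factors -/

/-- The limiting contribution of the jump at `c j`. -/
def jumpFactor (c : Fin r → ℝ) (fm fp : Fin r → ℝ) (R : Finset (Fin r)) (j : Fin r) (n : ℕ) : ℝ :=
  hbeta (logRoot (fm j)) (logRoot (fp j)) *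
    Real.exp ((n * c j - jumpIndex c R j n) * (logRoot (fp j) - logRoot (fm j)))

theorem jumpFactor_pos (h : PiecewiseSmooth c f fm fp ε R) (j : Fin r) (n : ℕ) :
    0 < jumpFactor c fm fp R j n :=
  mul_pos (hbeta_pos (logRoot_pos (h.two_lt_left j)) (logRoot_pos (h.two_lt_right j)))
    (Real.exp_pos _)

theorem tendsto_cellFactor_jump (h : PiecewiseSmooth c f fm fp ε R) (j : Fin r) :
    Tendsto (fun n => cellFactor f n (jumpIndex c R j n) / jumpFactor c fm fp R j n)
      atTop (𝓝 1) := by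
  have hgm := logRoot_pos (h.two_lt_left j)
  have hgp := logRoot_pos (h.two_lt_right j)
  have hb := hbeta_pos hgm hgp
  have h1 := (tendsto_hbeta hgm hgp (h.tendsto_left_value j) (h.tendsto_right_value j)).div_const
    (hbeta (logRoot (fm j)) (logRoot (fp j)))
  rw [div_self hb.ne'] at h1
  -- With `t = n * c j - jumpIndex c R j n`, the exponent tends to agree with `g₊ - t g₋ - (1 - t)
  -- g₊ = t (g₊ - g₋)`, where `g₋` and `g₊` are `logRoot` of the one-sided limits.
  have h2 := ((h.tendsto_right_value j).sub_const (logRoot (fp j))).sub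
    ((h.tendsto_integral_left j).add (h.tendsto_integral_right j))
  simp only [sub_self, add_zero] at h2
  have h3 := (Real.continuous_exp.tendsto 0).comp h2
  rw [Real.exp_zero] at h3
  have h4 := h1.mul h3
  rw [one_mul] at h4
  refine h4.congr' ?_
  filter_upwards [eventually_gt_atTop 0] with n hn
  have hn' : (0 : ℝ) < n := by positivity
  have hv : ((jumpIndex c R j n + 1 : ℕ) / n : ℝ) ≤ 1 := by
    rw [div_le_one hn']
    exact_mod_cast h.jumpIndex_lt j hn
  have hint := intervalIntegral.integral_add_adjacent_intervals
    (h.intervalIntegrable (by positivity) (h.jump_bounds j hn).1 (h.mem j).2.le)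
    (h.intervalIntegrable (h.mem j).1.le (h.jump_bounds j hn).2 hv)
  rw [cellFactor, jumpFactor, ← hint, mul_right_comm, ← Real.exp_add, mul_comm (Real.exp _),
    mul_div_mul_comm, ← Real.exp_sub]
  simp only [Function.comp]
  congr 2
  push_cast
  field_simp
  ring

theorem cellFactor_pos (h : PiecewiseSmooth c f fm fp ε R) (n k : ℕ) : 0 < cellFactor f n k := by
  have hp : ∀ k, 0 < gridRoot f n k := fun k => h.logRoot_gap_pos.trans_le (h.le_gridRoot n k)
  exact mul_pos (mul_pos (Real.exp_pos _) (hbeta_pos (hp _) (hp _))) (Real.exp_pos _)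

/-- Each logarithm is `O(1/n^2)` and there are at most `n` regular cells. -/
theorem tendsto_prod_regular (h : PiecewiseSmooth c f fm fp ε R) :
    Tendsto (fun n => ∏ k ∈ Finset.range n \ Finset.univ.image (jumpIndex c R · n),
      cellFactor f n k) atTop (𝓝 1) := by
  obtain ⟨L, M, hL, hM, hcell⟩ := h.exists_cell
  have hσ := h.logRoot_gap_pos
  have hρ := exp_neg_lt_one hσ
  set C := M + L ^ 2 / (1 - Real.exp (-logRoot (2 + ε))) ^ 2 with hC
  have hbound : ∀ n, ∀ k ∈ Finset.range n \ Finset.univ.image (jumpIndex c R · n),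
      |Real.log (cellFactor f n k)| ≤ C / n ^ 2 := by
    intro n k hk
    simp only [Finset.mem_sdiff, Finset.mem_range, Finset.mem_image, Finset.mem_univ, true_and,
      not_exists] at hk
    obtain ⟨h1, h2⟩ := hcell n k hk.1 hk.2
    have hle := h.le_gridRoot n
    have hb := abs_log_hbeta_le hσ (hle k) (hle (k + 1))
    have hn : (0 : ℝ) < n := by
      have : 0 < n := by omega
      positivity
    -- Writing `y = (x + y)/2 - (x - y)/2` separates the quadratic error of `log hbeta` from the
    -- trapezoidal error.
    have hlog : Real.log (cellFactor f n k) =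
        (Real.log (hbeta (gridRoot f n k) (gridRoot f n (k + 1))) -
          (gridRoot f n k - gridRoot f n (k + 1)) / 2) -
        (n * (∫ x in (k / n : ℝ)..((k + 1 : ℕ) / n : ℝ), logRoot (f x)) -
          (gridRoot f n k + gridRoot f n (k + 1)) / 2) := by
      have hh := hbeta_pos (hσ.trans_le (hle k)) (hσ.trans_le (hle (k + 1)))
      rw [cellFactor, Real.log_mul (by positivity) (by positivity),
        Real.log_mul (by positivity) (by positivity), Real.log_exp, Real.log_exp]
      ring
    have hsq : (gridRoot f n k - gridRoot f n (k + 1)) ^ 2 ≤ (L / n) ^ 2 := by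
      rw [← sq_abs, abs_sub_comm]
      gcongr
    rw [hlog]
    have hb' := hb.trans (div_le_div_of_nonneg_right hsq (sq_nonneg _))
    refine (abs_sub _ _).trans ((add_le_add hb' h2).trans (le_of_eq ?_))
    rw [hC, div_pow]
    ring
  have hsum : Tendsto (fun n => ∑ k ∈ Finset.range n \ Finset.univ.image (jumpIndex c R · n),
      Real.log (cellFactor f n k)) atTop (𝓝 0) := by
    refine squeeze_zero_norm (fun n => ?_) (tendsto_const_div_atTop_nhds_zero_nat C)
    have hC0 : 0 ≤ C := by positivity
    calc _ ≤ ∑ k ∈ Finset.range n \ Finset.univ.image (jumpIndex c R · n), C / (n : ℝ) ^ 2 :=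
          norm_sum_le_of_le _ (hbound n)
      _ ≤ ∑ k ∈ Finset.range n, C / (n : ℝ) ^ 2 :=
          Finset.sum_le_sum_of_subset_of_nonneg Finset.sdiff_subset fun _ _ _ => by positivity
      _ = C / n := by
          rw [Finset.sum_const, Finset.card_range, nsmul_eq_mul]
          rcases Nat.eq_zero_or_pos n with rfl | hn
          · simp
          · field_simp
  have := (Real.continuous_exp.tendsto 0).comp hsum
  rw [Real.exp_zero] at this
  refine this.congr fun n => ?_
  rw [Function.comp, Real.exp_sum]
  exact Finset.prod_congr rfl fun k _ => Real.exp_log (h.cellFactor_pos n k)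

theorem tendsto_prod_cellFactor (h : PiecewiseSmooth c f fm fp ε R) :
    Tendsto (fun n => (∏ k ∈ Finset.range n, cellFactor f n k) /
      ∏ j, jumpFactor c fm fp R j n) atTop (𝓝 1) := by
  have h1 := h.tendsto_prod_regular.mul
    (tendsto_finsetProd Finset.univ fun j _ => h.tendsto_cellFactor_jump j)
  simp only [Finset.prod_const_one, mul_one] at h1
  refine h1.congr' ?_
  -- Once the jump cells are distinct, the product over them is a product over `j`.
  have hinj : ∀ᶠ n in atTop, Function.Injective (jumpIndex c R · n) := by
    have : ∀ᶠ n in atTop, ∀ j j' : Fin r, j ≠ j' → jumpIndex c R j n ≠ jumpIndex c R j' n := by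
      refine eventually_all.2 fun j => eventually_all.2 fun j' => ?_
      by_cases hj : j = j'
      · simp [hj]
      · filter_upwards [h.eventually_far 0 hj] with n hn _
        omega
    filter_upwards [this] with n hn j j' hjj'
    exact not_imp_comm.1 (hn j j') (not_not.2 hjj')
  filter_upwards [hinj, eventually_gt_atTop 0] with n hn hn0
  have hsub : Finset.univ.image (jumpIndex c R · n) ⊆ Finset.range n := by
    intro k hk
    simp only [Finset.mem_image, Finset.mem_univ, true_and] at hk
    obtain ⟨j, rfl⟩ := hk
    exact Finset.mem_range.2 (h.jumpIndex_lt j hn0)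
  rw [← Finset.prod_sdiff hsub, Finset.prod_image hn.injOn, Finset.prod_div_distrib, mul_div_assoc]

/-! ### Assembly of the asymptotic formula -/

theorem D_eq (f : ℝ → ℝ) (n : ℕ) :
    D n f = (tridiag (fun k => f ((min k n : ℕ) / (n : ℝ))) n).det := by
  have : T n f = tridiag (fun k => f ((min k n : ℕ) / (n : ℝ))) n := by
    ext i j
    have hi : min ((i : ℕ) + 1) n = i + 1 := min_eq_left i.isLt
    simp only [T, tridiag, Matrix.of_apply, hi, Nat.cast_add, Nat.cast_one]
  rw [D, this]

theorem G_pow_eq (h : PiecewiseSmooth c f fm fp ε R) {n : ℕ} (hn : 0 < n) :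
    G f ^ n = ∏ k ∈ Finset.range n,
      Real.exp (n * ∫ x in (k / n : ℝ)..((k + 1 : ℕ) / n : ℝ), logRoot (f x)) := by
  have hn' : (0 : ℝ) < n := by positivity
  have hsum := intervalIntegral.sum_integral_adjacent_intervals (μ := MeasureTheory.volume)
    (f := fun x => logRoot (f x)) (a := fun k : ℕ => (k / n : ℝ)) (n := n) fun k hk => by
      refine h.intervalIntegrable (by positivity) (by gcongr; omega) ?_
      rw [div_le_one hn']
      exact_mod_cast hk
  simp only [Nat.cast_zero, zero_div, div_self hn'.ne'] at hsum
  rw [← Real.exp_sum, ← Finset.mul_sum, hsum, G, ← Real.exp_nat_mul]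
  rfl

theorem D_div_G_pow_eq (h : PiecewiseSmooth c f fm fp ε R) {n : ℕ} (hn : 0 < n) :
    D n f / G f ^ n = alpha (f 0) (f 1) * (∏ k ∈ Finset.range n, cellFactor f n k) *
      ((∏ k ∈ Finset.range n, (1 + defect (gridRoot f n) k)) *
      ((1 - Real.exp (-gridRoot f n n) * Real.exp (-gridRoot f n n)) /
        (1 - ratio (gridRoot f n) n * Real.exp (-gridRoot f n n)))) := by
  have hn' : (0 : ℝ) < n := by positivity
  have hpos : ∀ k, 0 < gridRoot f n k := fun k => h.logRoot_gap_pos.trans_le (h.le_gridRoot n k)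
  have hdet := det_tridiag_mul_one_sub (gridRoot f n) (fun k => f ((min k n : ℕ) / (n : ℝ))) hpos
    (fun k => (exp_logRoot_add (h.two_lt (grid_mem n k))).symm) n
  rw [← D_eq] at hdet
  have h0 : gridRoot f n 0 = logRoot (f 0) := by simp [gridRoot]
  have h1 : gridRoot f n n = logRoot (f 1) := by simp [gridRoot, hn'.ne']
  have hα := alpha_eq (h.two_lt (Set.left_mem_Icc.2 zero_le_one))
    (h.two_lt (Set.right_mem_Icc.2 zero_le_one))
  rw [← h0, ← h1] at hα
  rw [← hα] at hdet
  have hr := ratio_mem (gridRoot f n) n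
  have hm := exp_neg_lt_one (hpos n)
  have hm0 := Real.exp_pos (-gridRoot f n n)
  have hd : 1 - ratio (gridRoot f n) n * Real.exp (-gridRoot f n n) ≠ 0 := by nlinarith
  have hcell : ∏ k ∈ Finset.range n, cellFactor f n k = (∏ k ∈ Finset.range n,
      (Real.exp (gridRoot f n (k + 1)) * hbeta (gridRoot f n k) (gridRoot f n (k + 1)))) /
        G f ^ n := by
    rw [h.G_pow_eq hn, ← Finset.prod_div_distrib]
    refine Finset.prod_congr rfl fun k _ => ?_
    rw [cellFactor, Real.exp_neg, ← div_eq_mul_inv]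
  rw [Finset.prod_mul_distrib] at hdet
  rw [hcell, eq_div_iff hd |>.2 hdet]
  ring

/-- The jump factors oscillate with `n` and need not converge. Their boundedness turns a quotient
tending to `1` into a difference tending to `0`. -/
theorem exists_prod_jumpFactor_le (h : PiecewiseSmooth c f fm fp ε R) :
    ∃ B, ∀ n, 0 < n → |∏ j, jumpFactor c fm fp R j n| ≤ B := by
  refine ⟨∏ j, (hbeta (logRoot (fm j)) (logRoot (fp j)) *
    Real.exp |logRoot (fp j) - logRoot (fm j)|), fun n hn => ?_⟩
  rw [abs_of_pos (Finset.prod_pos fun j _ => h.jumpFactor_pos j n)]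
  refine Finset.prod_le_prod (fun j _ => (h.jumpFactor_pos j n).le) fun j _ => ?_
  have hb := hbeta_pos (logRoot_pos (h.two_lt_left j)) (logRoot_pos (h.two_lt_right j))
  have h1 := (h.jumpIndex_le j hn).1
  have h2 := (h.le_jumpIndex j hn).1
  unfold jumpFactor
  gcongr
  refine (le_abs_self _).trans ?_
  rw [abs_mul, abs_of_nonneg (by linarith)]
  exact mul_le_of_le_one_left (abs_nonneg _) (by linarith)

theorem tendsto_D_div_G_pow (h : PiecewiseSmooth c f fm fp ε R) :
    Tendsto (fun n : ℕ => D n f / G f ^ n - alpha (f 0) (f 1) *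
      ∏ j, beta (fm j) (fp j) * gamma (fm j) (fp j) ^
        (if j ∈ R then fract' ((n : ℝ) * c j) else Int.fract ((n : ℝ) * c j))) atTop (𝓝 0) := by
  obtain ⟨L, hstep⟩ := h.stepArray
  obtain ⟨B, hB⟩ := h.exists_prod_jumpFactor_le
  have h1 := ((h.tendsto_prod_cellFactor.mul hstep.tendsto_error).sub_const 1).norm
  simp only [mul_one, sub_self, norm_zero] at h1
  have h2 := h1.const_mul (|alpha (f 0) (f 1)| * B)
  rw [mul_zero] at h2
  refine squeeze_zero_norm' ?_ h2
  filter_upwards [eventually_gt_atTop 0] with n hn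
  have hJ : ∏ j, jumpFactor c fm fp R j n = ∏ j, beta (fm j) (fp j) * gamma (fm j) (fp j) ^
      (if j ∈ R then fract' ((n : ℝ) * c j) else Int.fract ((n : ℝ) * c j)) := by
    refine Finset.prod_congr rfl fun j _ => ?_
    rw [h.exponent_eq j hn, beta_eq (h.two_lt_left j) (h.two_lt_right j),
      gamma_rpow (h.two_lt_left j) (h.two_lt_right j), jumpFactor]
  have hJ0 : ∏ j, jumpFactor c fm fp R j n ≠ 0 :=
    (Finset.prod_pos fun j _ => h.jumpFactor_pos j n).ne'
  rw [← hJ, h.D_div_G_pow_eq hn]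
  set J := ∏ j, jumpFactor c fm fp R j n
  set P := ∏ k ∈ Finset.range n, cellFactor f n k
  set E := (∏ k ∈ Finset.range n, (1 + defect (gridRoot f n) k)) *
      ((1 - Real.exp (-gridRoot f n n) * Real.exp (-gridRoot f n n)) /
        (1 - ratio (gridRoot f n) n * Real.exp (-gridRoot f n n)))
  -- `P / J` and `E` both tend to `1`, while `J` is only bounded.
  have hfac : alpha (f 0) (f 1) * P * E - alpha (f 0) (f 1) * J =
      alpha (f 0) (f 1) * J * (P / J * E - 1) := by
    field_simp
  rw [hfac, norm_mul, norm_mul, Real.norm_eq_abs, Real.norm_eq_abs]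
  gcongr
  exact hB n hn

end PiecewiseSmooth

end DiscreteSchrodinger

end

theorem mainTheorem8 (r : ℕ) (c : Fin r → ℝ) (hc_inj : Function.Injective c)
    (hc : ∀ j, c j ∈ Set.Ioo (0 : ℝ) 1)
    (f : ℝ → ℝ)
    (hf : DiscreteSchrodinger.TwiceDiffBddOn f (Set.Icc (0 : ℝ) 1 \ Set.range c))
    (fm fp : Fin r → ℝ)
    (hfm : ∀ j, Tendsto f (𝓝[<] (c j)) (𝓝 (fm j)))
    (hfp : ∀ j, Tendsto f (𝓝[>] (c j)) (𝓝 (fp j)))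
    (ε : ℝ) (hε : 0 < ε) (hf2 : ∀ x ∈ Set.Icc (0 : ℝ) 1, 2 + ε < f x) :
    -- (i) `f` is left-continuous at every `c j`
    ((∀ j, f (c j) = fm j) →
      Tendsto (fun n : ℕ =>
        DiscreteSchrodinger.D n f / DiscreteSchrodinger.G f ^ n -
          DiscreteSchrodinger.alpha (f 0) (f 1) *
            ∏ j, DiscreteSchrodinger.beta (fm j) (fp j) *
              DiscreteSchrodinger.gamma (fm j) (fp j) ^ Int.fract ((n : ℝ) * c j))
        atTop (𝓝 0)) ∧
    -- (ii) `f` is right-continuous at the `c j` with `j ∈ R`, left-continuous at the others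
    (∀ R : Finset (Fin r), (∀ j ∈ R, f (c j) = fp j) → (∀ j ∉ R, f (c j) = fm j) →
      Tendsto (fun n : ℕ =>
        DiscreteSchrodinger.D n f / DiscreteSchrodinger.G f ^ n -
          DiscreteSchrodinger.alpha (f 0) (f 1) *
            ∏ j, DiscreteSchrodinger.beta (fm j) (fp j) *
              DiscreteSchrodinger.gamma (fm j) (fp j) ^
                (if j ∈ R then DiscreteSchrodinger.fract' ((n : ℝ) * c j)
                  else Int.fract ((n : ℝ) * c j)))
        atTop (𝓝 0)) := by
  have key : ∀ R : Finset (Fin r), (∀ j ∈ R, f (c j) = fp j) → (∀ j ∉ R, f (c j) = fm j) →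
      DiscreteSchrodinger.PiecewiseSmooth c f fm fp ε R := fun R hR hR' =>
    ⟨hc_inj, hc, hf, hfm, hfp, hε, hf2, hR, hR'⟩
  refine ⟨fun h => ?_, fun R hR hR' => (key R hR hR').tendsto_D_div_G_pow⟩
  simpa only [Finset.notMem_empty, if_false] using
    (key ∅ (by simp) fun j _ => h j).tendsto_D_div_G_pow
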